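/- Let $\mathbf{32}$ be the real $32$-dimensional Majorana representation of $\mathrm{Pin}^+(1,10)$, with Clifford generators $\Gamma_0,\dots,\Gamma_{10}$ satisfying $\Gamma_a\Gamma_b+\Gamma_b\Gamma_a=2\eta_{ab}$ for $\eta=\mathrm{diag}(-1,+1,\dots,+1)$ and $\Gamma_0\Gamma_1\cdots\Gamma_{10}=1$, and with a non-degenerate skew-symmetric bilinear pairing $(\overline{\phi}\,\psi)$ for which every $\Gamma_a$ is skew self-adjoint, $(\overline{\Gamma_a\phi}\,\psi)=-(\overline{\phi}\,\Gamma_a\psi)$. Write $\Gamma_{a_1\cdots a_p}:=\tfrac1{p!}\sum_{\sigma}\mathrm{sgn}(\sigma)\,\Gamma_{a_{\sigma(1)}}\cdots\Gamma_{a_{\sigma(p)}}$ and $\Gamma^a:=\eta^{ab}\Gamma_b$. As a $\mathrm{Spin}(1,9)$-representation, $\mathbf{32}=\mathbf{16}\oplus\overline{\mathbf{16}}$, the summands being the images of $\tfrac12(1\pm\Gamma_{10})$. Let $\mathrm{CE}(\mathbb{R}^{1,9|\mathbf{16}\oplus\overline{\mathbf{16}}})$ be the Chevalley--Eilenberg algebra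 of the type IIA super-Minkowski algebra: the $(\mathbb{Z}\times\mathbb{Z}_2)$-graded-commutative real algebra generated by $\psi^\alpha$ ($\alpha=1,\dots,32$) in degree $(1,\mathrm{odd})$ and $e^a$ ($a=0,\dots,9$) in degree $(1,\mathrm{even})$, with sign rule $xy=(-1)^{n_xn_y+\sigma_x\sigma_y}\,yx$ for $\deg x=(n_x,\sigma_x)$, $\deg y=(n_y,\sigma_y)$, and with differential $\mathrm{d}$ the graded derivation of degree $(1,\mathrm{even})$ determined by $$\mathrm{d}\psi^\alpha=0,\qquad \mathrm{d}e^a=(\overline{\psi}\,\Gamma^a\,\psi).$$ With the summation convention, all $a_i$ running over $0,\dots,9$, consider in this algebra $$H_3^A:=(\overline{\psi}\,\Gamma_a\Gamma_{10}\,\psi)\,e^a,\qquad F_6:=\tfrac1{4!}(\overline{\psi}\,\Gamma_{a_1\cdots a_4}\Gamma_{10}\,\psi)\,e^{a_1}\cdots e^{a_4},\qquad F_8:=\tfrac1{6!}(\overline{\psi}\,\Gamma_{a_1\cdots a_6}\,\psi)\,e^{a_1}\cdots e^{a_6},$$ $$F_{10}:=\tfrac1{8!}(\overline{\psi}\,\Gamma_{a_1\cdots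 a_8}\Gamma_{10}\,\psi)\,e^{a_1}\cdots e^{a_8},\qquad F_{12}:=\tfrac1{10!}(\overline{\psi}\,\Gamma_{a_1\cdots a_{10}}\,\psi)\,e^{a_1}\cdots e^{a_{10}}.$$ Then $$\mathrm{d}F_8=H_3^A\,F_6,\qquad \mathrm{d}F_{10}=H_3^A\,F_8,\qquad \mathrm{d}F_{12}=H_3^A\,F_{10},\qquad H_3^A\,F_{12}=0.$$ -/

import Mathlib

noncomputable section

namespace SuperIIA

/-! ## The Majorana spinors in 11 dimensions -/

/-- The mostly-plus Minkowski metric `diag(-1, +1, …, +1)` in dimension `1 + 10`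
(equal to its own inverse). -/
def minkowski (a b : Fin 11) : ℝ :=
  if a = b then (if a = 0 then -1 else 1) else 0

/-- The real 32-dimensional (Majorana) pinor representation `𝟑𝟐` of `Pin⁺(1,10)` together with
its spinor pairing, in components with respect to an arbitrary linear basis of `𝟑𝟐`:
`gamma a` is the matrix `(Γ_a)^α_β` and `pairing` is the matrix `η_{αβ}` with
`(ψ̄ φ) = ψ^α η_{αβ} φ^β`. -/
structure MajoranaRep where
  /-- The Clifford generators `Γ_0, …, Γ_10`. -/
  gamma : Fin 11 → Matrix (Fin 32) (Fin 32) ℝ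
  /-- The spinor metric. -/
  pairing : Matrix (Fin 32) (Fin 32) ℝ
  /-- `Γ_a Γ_b + Γ_b Γ_a = 2 η_{ab}`. -/
  clifford : ∀ a b, gamma a * gamma b + gamma b * gamma a =
    (2 * minkowski a b) • (1 : Matrix (Fin 32) (Fin 32) ℝ)
  /-- `Γ_0 Γ_1 ⋯ Γ_10 = 1`. -/
  volume_eq : (List.ofFn gamma).prod = 1
  /-- The spinor pairing is skew-symmetric. -/
  pairing_skew : pairing.transpose = -pairing
  /-- The spinor pairing is non-degenerate. -/
  pairing_nondegenerate : IsUnit pairing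
  /-- The Clifford generators are skew self-adjoint: `(Γ_a φ)‾ ψ = - φ̄ (Γ_a ψ)`. -/
  gamma_skew_adjoint : ∀ a, (gamma a).transpose * pairing = -(pairing * gamma a)

namespace MajoranaRep

variable (M : MajoranaRep)

/-- The Clifford generators with raised index, `Γ^a = η^{ab} Γ_b`. -/
def gammaUp (a : Fin 11) : Matrix (Fin 32) (Fin 32) ℝ :=
  ∑ b, minkowski a b • M.gamma b

/-- The skew-symmetrized product `Γ_{a_1 ⋯ a_k}` of Clifford generators. -/
def gammaSkew {k : ℕ} (a : Fin k → Fin 11) : Matrix (Fin 32) (Fin 32) ℝ :=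
  ((k.factorial : ℝ)⁻¹) • ∑ σ : Equiv.Perm (Fin k),
    ((Equiv.Perm.sign σ : ℤ) : ℝ) • (List.ofFn fun i => M.gamma (a (σ i))).prod

end MajoranaRep

/-! ## The graded-commutative algebra underlying the Chevalley–Eilenberg algebra -/

/-- The generators `ψ^α` (for `α = 1, …, 32`, the components of `ψ = ψ₁ + ψ₂` in
`𝟑𝟐 = 𝟏𝟔 ⊕ 𝟏𝟔bar`) and `e^a` (for `a = 0, …, 9`). -/
inductive Gen : Type
  | psi (α : Fin 32)
  | e (a : Fin 10)

/-- The bidegree in `ℤ × ℤ/2`: `deg ψ^α = (1, odd)` and `deg e^a = (1, even)`. -/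
def Gen.bideg : Gen → ℤ × ZMod 2
  | .psi _ => (1, 1)
  | .e _ => (1, 0)

/-- The sign `(-1)^(n₁ n₂ + σ₁ σ₂)` of the bigraded sign rule. -/
def bisign (p q : ℤ × ZMod 2) : ℝ :=
  (((p.1 * q.1 + (p.2.val : ℤ) * (q.2.val : ℤ)).negOnePow : ℤˣ) : ℤ)

/-- The bigraded sign rule `x y = (-1)^(n₁ n₂ + σ₁ σ₂) y x` on generators. -/
inductive SignRule : FreeAlgebra ℝ Gen → FreeAlgebra ℝ Gen → Prop
  | swap (x y : Gen) : SignRule (FreeAlgebra.ι ℝ x * FreeAlgebra.ι ℝ y)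
      (bisign x.bideg y.bideg • (FreeAlgebra.ι ℝ y * FreeAlgebra.ι ℝ x))

/-- The bigraded-commutative algebra `ℝ[(ψ^α)_α, (e^a)_a]` underlying the Chevalley–Eilenberg
algebra of the type IIA super-Minkowski algebra. -/
def CE : Type := RingQuot SignRule

namespace CE

instance : Semiring CE := inferInstanceAs (Semiring (RingQuot SignRule))

instance : Algebra ℝ CE := inferInstanceAs (Algebra ℝ (RingQuot SignRule))

instance : Ring CE := Algebra.semiringToRing ℝ

/-- The quotient map. -/
def mk : FreeAlgebra ℝ Gen →ₐ[ℝ] CE := RingQuot.mkAlgHom ℝ SignRule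

theorem mk_surjective : Function.Surjective mk := RingQuot.mkAlgHom_surjective ℝ SignRule

theorem mk_rel {a b : FreeAlgebra ℝ Gen} (h : SignRule a b) : mk a = mk b :=
  RingQuot.mkAlgHom_rel ℝ h

/-- The generators as elements of the algebra. -/
def gen (x : Gen) : CE := mk (FreeAlgebra.ι ℝ x)

/-- The generator `ψ^α`. -/
def psi (α : Fin 32) : CE := gen (.psi α)

/-- The generator `e^a`. -/
def e (a : Fin 10) : CE := gen (.e a)

theorem gen_swap (x y : Gen) : gen x * gen y = bisign x.bideg y.bideg • (gen y * gen x) := by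
  have h := mk_rel (SignRule.swap x y)
  rwa [map_mul, map_smul, map_mul] at h

theorem psi_psi (α β : Fin 32) : psi α * psi β = psi β * psi α := by
  have h := gen_swap (.psi α) (.psi β)
  have hs : bisign (Gen.psi α).bideg (Gen.psi β).bideg = 1 := by
    simp [bisign, Gen.bideg, ZMod.val_one]
  rwa [hs, one_smul] at h

theorem e_psi (a : Fin 10) (α : Fin 32) : e a * psi α = -(psi α * e a) := by
  have h := gen_swap (.e a) (.psi α)
  have hs : bisign (Gen.e a).bideg (Gen.psi α).bideg = -1 := by
    simp [bisign, Gen.bideg]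
  rwa [hs, neg_one_smul] at h

theorem e_e (a b : Fin 10) : e a * e b = -(e b * e a) := by
  have h := gen_swap (.e a) (.e b)
  have hs : bisign (Gen.e a).bideg (Gen.e b).bideg = -1 := by
    simp [bisign, Gen.bideg]
  rwa [hs, neg_one_smul] at h

/-- Algebra maps out of `CE` are determined by images of generators that obey the sign rule. -/
def lift {A : Type} [Ring A] [Algebra ℝ A] (f : Gen → A)
    (hf : ∀ x y, f x * f y = bisign x.bideg y.bideg • (f y * f x)) : CE →ₐ[ℝ] A :=
  RingQuot.liftAlgHom ℝ ⟨FreeAlgebra.lift ℝ f, by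
    rintro _ _ ⟨x, y⟩
    simpa using hf x y⟩

theorem lift_gen {A : Type} [Ring A] [Algebra ℝ A] (f : Gen → A)
    (hf : ∀ x y, f x * f y = bisign x.bideg y.bideg • (f y * f x)) (x : Gen) :
    lift f hf (gen x) = f x := by
  have h := RingQuot.liftAlgHom_mkAlgHom_apply ℝ (FreeAlgebra.lift ℝ f) (s := SignRule) (by
    rintro _ _ ⟨x, y⟩
    simpa using hf x y) (FreeAlgebra.ι ℝ x)
  rw [FreeAlgebra.lift_ι_apply] at h
  exact h

theorem induction {P : CE → Prop} (halg : ∀ r : ℝ, P (algebraMap ℝ CE r))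
    (hgen : ∀ x, P (gen x)) (hadd : ∀ x y, P x → P y → P (x + y))
    (hmul : ∀ x y, P x → P y → P (x * y)) (x : CE) : P x := by
  obtain ⟨y, rfl⟩ := mk_surjective x
  induction y using FreeAlgebra.induction with
  | grade0 r => rw [AlgHom.commutes]; exact halg r
  | grade1 x => exact hgen x
  | mul a b ha hb => rw [map_mul]; exact hmul _ _ ha hb
  | add a b ha hb => rw [map_add]; exact hadd _ _ ha hb

/-- The parity involution `x ↦ (-1)^n x` for `n` the homological degree of `x`
(all generators have homological degree 1). -/
def parity : CE →ₐ[ℝ] CE :=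
  lift (fun x => -gen x) (fun x y => by simpa using gen_swap x y)

theorem parity_gen (x : Gen) : parity (gen x) = -gen x := lift_gen _ _ x

end CE

namespace MajoranaRep

variable (M : MajoranaRep)

open CE

/-- For a matrix `A` acting on spinors, the element
`(ψ̄ A ψ) = η_{αα'} A^{α'}_β ψ^α ψ^β` of the Chevalley–Eilenberg algebra. -/
def bilinear (A : Matrix (Fin 32) (Fin 32) ℝ) : CE :=
  ∑ α, ∑ β, (M.pairing * A) α β • (psi α * psi β)

theorem psi_bilinear (α : Fin 32) (A : Matrix (Fin 32) (Fin 32) ℝ) :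
    psi α * M.bilinear A = M.bilinear A * psi α := by
  simp only [bilinear, Finset.mul_sum, Finset.sum_mul, mul_smul_comm, smul_mul_assoc]
  refine Finset.sum_congr rfl fun β _ => Finset.sum_congr rfl fun γ _ => ?_
  rw [← mul_assoc, psi_psi α β, mul_assoc, psi_psi α γ, mul_assoc]

theorem e_bilinear (a : Fin 10) (A : Matrix (Fin 32) (Fin 32) ℝ) :
    e a * M.bilinear A = M.bilinear A * e a := by
  simp only [bilinear, Finset.mul_sum, Finset.sum_mul, mul_smul_comm, smul_mul_assoc]
  refine Finset.sum_congr rfl fun β _ => Finset.sum_congr rfl fun γ _ => ?_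
  rw [← mul_assoc, e_psi, neg_mul, mul_assoc, e_psi, mul_neg, neg_neg, mul_assoc]

/-! ## The differential -/

/-- The differential on generators: `d ψ^α = 0` and `d e^a = (ψ̄ Γ^a ψ)`. -/
def dGen : Gen → CE
  | .psi _ => 0
  | .e a => M.bilinear (M.gammaUp a.castSucc)

theorem gen_dGen (x y : Gen) : gen x * M.dGen y = M.dGen y * gen x := by
  cases y with
  | psi β => simp [dGen]
  | e b => cases x with
    | psi α => exact M.psi_bilinear α _
    | e a => exact M.e_bilinear a _

theorem dGen_swap (x y : Gen) : M.dGen x * gen y - gen x * M.dGen y =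
    bisign x.bideg y.bideg • (M.dGen y * gen x - gen y * M.dGen x) := by
  cases x with
  | psi α => cases y with
    | psi β => simp [dGen]
    | e b =>
      have hs : bisign (Gen.psi α).bideg (Gen.e b).bideg = -1 := by simp [bisign, Gen.bideg]
      have h := M.gen_dGen (.psi α) (.e b)
      have h0 : M.dGen (.psi α) = 0 := rfl
      rw [hs, h, h0]; simp
  | e a => cases y with
    | psi β =>
      have hs : bisign (Gen.e a).bideg (Gen.psi β).bideg = -1 := by simp [bisign, Gen.bideg]
      have h := M.gen_dGen (.psi β) (.e a)
      have h0 : M.dGen (.psi β) = 0 := rfl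
      rw [hs, h, h0]; simp
    | e b =>
      have hs : bisign (Gen.e a).bideg (Gen.e b).bideg = -1 := by simp [bisign, Gen.bideg]
      rw [hs, M.gen_dGen (.e a) (.e b), M.gen_dGen (.e b) (.e a)]; simp

/-- A graded derivation `d` is the same as the upper right entry of an algebra map
`x ↦ [[(-1)^n x, d x], [0, x]]`. -/
def dMat : CE →ₐ[ℝ] Matrix (Fin 2) (Fin 2) CE :=
  CE.lift (fun x => !![-gen x, M.dGen x; 0, gen x]) (fun x y => by
    have h1 := gen_swap x y
    have h2 := M.dGen_swap x y
    ext i j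
    fin_cases i <;> fin_cases j
    · simpa [Matrix.mul_apply] using h1
    · simpa [Matrix.mul_apply, sub_eq_neg_add] using h2
    · simp [Matrix.mul_apply]
    · simpa [Matrix.mul_apply] using h1)

/-- The differential `d` of the Chevalley–Eilenberg algebra
`CE(ℝ^{1,9|𝟏𝟔 ⊕ 𝟏𝟔bar})`: the graded derivation with `d ψ^α = 0` and `d e^a = (ψ̄ Γ^a ψ)`. -/
def d : CE →ₗ[ℝ] CE where
  toFun x := M.dMat x 0 1
  map_add' x y := by simp
  map_smul' r x := by simp

theorem dMat_gen (x : Gen) : M.dMat (gen x) = !![-gen x, M.dGen x; 0, gen x] :=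
  CE.lift_gen _ _ x

theorem dMat_eq (x : CE) : M.dMat x = !![parity x, M.d x; 0, x] := by
  have key : M.dMat x 0 0 = parity x ∧ M.dMat x 1 0 = 0 ∧ M.dMat x 1 1 = x := by
    induction x using CE.induction with
    | halg r => simp [Matrix.algebraMap_matrix_apply]
    | hgen x => simp [dMat_gen, parity_gen]
    | hadd x y hx hy => simp [hx, hy]
    | hmul x y hx hy => simp [Matrix.mul_apply, hx, hy]
  ext i j
  fin_cases i <;> fin_cases j
  · simpa using key.1
  · rfl
  · simpa using key.2.1
  · simpa using key.2.2

theorem d_psi (α : Fin 32) : M.d (psi α) = 0 := by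
  simp [d, psi, dMat_gen, dGen]

theorem d_e (a : Fin 10) : M.d (e a) = M.bilinear (M.gammaUp a.castSucc) := by
  simp [d, e, dMat_gen, dGen]

/-- The graded Leibniz rule. -/
theorem d_mul (x y : CE) : M.d (x * y) = M.d x * y + parity x * M.d y := by
  have h : M.d (x * y) = (M.dMat x * M.dMat y) 0 1 := by
    rw [← map_mul]; rfl
  rw [h, dMat_eq, dMat_eq]
  simp [Matrix.mul_apply, add_comm]

theorem d_algebraMap (r : ℝ) : M.d (algebraMap ℝ CE r) = 0 := by
  have h : M.d (algebraMap ℝ CE r) = (algebraMap ℝ (Matrix (Fin 2) (Fin 2) CE) r) 0 1 := by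
    rw [← M.dMat.commutes]; rfl
  rw [h]; simp [Matrix.algebraMap_matrix_apply]

theorem parity_bilinear (A : Matrix (Fin 32) (Fin 32) ℝ) :
    parity (M.bilinear A) = M.bilinear A := by
  simp [bilinear, psi, parity_gen]

theorem d_bilinear (A : Matrix (Fin 32) (Fin 32) ℝ) : M.d (M.bilinear A) = 0 := by
  simp [bilinear, d_mul, d_psi]

theorem parity_parity (x : CE) : parity (parity x) = x := by
  induction x using CE.induction with
  | halg r => simp
  | hgen x => simp [parity_gen]
  | hadd x y hx hy => simp [hx, hy]
  | hmul x y hx hy => simp [hx, hy]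

theorem d_parity (x : CE) : M.d (parity x) = -parity (M.d x) := by
  induction x using CE.induction with
  | halg r => simp [d_algebraMap]
  | hgen x =>
    cases x with
    | psi α =>
      have h := M.d_psi α
      unfold psi at h
      simp [parity_gen, h]
    | e a =>
      have h := M.d_e a
      unfold e at h
      simp [parity_gen, h, parity_bilinear]
  | hadd x y hx hy => simp [hx, hy, add_comm]
  | hmul x y hx hy =>
    rw [map_mul, d_mul, d_mul, hx, hy, parity_parity, map_add, map_mul, map_mul, parity_parity]
    noncomm_ring

/-- The differential squares to zero. -/
theorem d_d (x : CE) : M.d (M.d x) = 0 := by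
  induction x using CE.induction with
  | halg r => simp [d_algebraMap]
  | hgen x =>
    cases x with
    | psi α => simp [← psi.eq_def, d_psi]
    | e a => simp [← e.eq_def, d_e, d_bilinear]
  | hadd x y hx hy => simp [hx, hy]
  | hmul x y hx hy => simp [d_mul, hx, hy, parity_parity, d_parity]

/-! ## The super-flux densities -/

/-- `(1/p!) (ψ̄ Γ_{a_1 ⋯ a_p} A ψ) e^{a_1} ⋯ e^{a_p}`, summed over `a_i = 0, …, 9`. -/
def flux (p : ℕ) (A : Matrix (Fin 32) (Fin 32) ℝ) : CE :=
  ((p.factorial : ℝ)⁻¹) • ∑ a : Fin p → Fin 10,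
    M.bilinear (M.gammaSkew (fun i => (a i).castSucc) * A) * (List.ofFn fun i => e (a i)).prod

/-- `H_3^A = (ψ̄ Γ_a Γ_10 ψ) e^a`. -/
def H3A : CE := ∑ a : Fin 10, M.bilinear (M.gamma a.castSucc * M.gamma 10) * e a

/-- `F_6 = (1/4!) (ψ̄ Γ_{a_1 ⋯ a_4} Γ_10 ψ) e^{a_1} ⋯ e^{a_4}`. -/
def F6 : CE := M.flux 4 (M.gamma 10)

/-- `F_8 = (1/6!) (ψ̄ Γ_{a_1 ⋯ a_6} ψ) e^{a_1} ⋯ e^{a_6}`. -/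
def F8 : CE := M.flux 6 1

/-- `F_10 = (1/8!) (ψ̄ Γ_{a_1 ⋯ a_8} Γ_10 ψ) e^{a_1} ⋯ e^{a_8}`. -/
def F10 : CE := M.flux 8 (M.gamma 10)

/-- `F_12 = (1/10!) (ψ̄ Γ_{a_1 ⋯ a_10} ψ) e^{a_1} ⋯ e^{a_10}`. -/
def F12 : CE := M.flux 10 1

end MajoranaRep

/-! ## Existence of the Majorana representation -/

namespace Model

/-- The sign `(-1)^(number of bits of x)`. -/
def bitSign (x : Fin 32) : ℤ :=
  ∏ i : Fin 5, if x.val.testBit i.val then -1 else 1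

theorem bitSign_xor : ∀ x y : Fin 32, bitSign (x ^^^ y) = bitSign x * bitSign y := by
  decide +kernel

theorem and_xor : ∀ z x y : Fin 32, z &&& (x ^^^ y) = (z &&& x) ^^^ (z &&& y) := by
  decide +kernel

theorem xor_and : ∀ z x y : Fin 32, (x ^^^ y) &&& z = (x &&& z) ^^^ (y &&& z) := by
  decide +kernel

theorem eq_xor : ∀ i j m : Fin 32, i = j ^^^ m ↔ j = i ^^^ m := by
  decide +kernel

theorem xor_assoc' : ∀ i j m : Fin 32, (i ^^^ j) ^^^ m = i ^^^ (j ^^^ m) := by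
  decide +kernel

theorem xor_comm' : ∀ i j : Fin 32, i ^^^ j = j ^^^ i := by
  decide +kernel

/-- The real Pauli-type matrix `X^m Z^z` on five real two-component systems. -/
def pauli (m z : Fin 32) : Matrix (Fin 32) (Fin 32) ℝ :=
  Matrix.of fun i j => if i = j ^^^ m then (bitSign (z &&& j) : ℝ) else 0

theorem pauli_mul (m z m' z' : Fin 32) :
    pauli m z * pauli m' z' =
      (bitSign (z &&& m') : ℝ) • pauli (m ^^^ m') (z ^^^ z') := by
  ext i j
  have h1 : (j ^^^ m') ^^^ m = j ^^^ (m ^^^ m') := by rw [xor_assoc', xor_comm' m']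
  simp only [pauli, Matrix.mul_apply, Matrix.of_apply, Matrix.smul_apply, smul_eq_mul, mul_ite,
    mul_zero, Finset.sum_ite_eq', Finset.mem_univ, if_true, h1]
  split_ifs
  · rw [and_xor, xor_and, bitSign_xor, bitSign_xor]; push_cast; ring
  · simp

theorem pauli_zero : pauli 0 0 = 1 := by
  ext i j
  have h1 : ∀ j : Fin 32, j ^^^ 0 = j ∧ bitSign (0 &&& j) = 1 := by decide +kernel
  simp [pauli, Matrix.one_apply, h1]

theorem pauli_transpose (m z : Fin 32) :
    (pauli m z).transpose = (bitSign (z &&& m) : ℝ) • pauli m z := by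
  ext i j
  simp only [pauli, Matrix.transpose_apply, Matrix.of_apply, Matrix.smul_apply, smul_eq_mul,
    mul_ite, mul_zero]
  by_cases h : i = j ^^^ m
  · rw [if_pos h, if_pos ((eq_xor i j m).1 h), h, and_xor, bitSign_xor]; push_cast; ring
  · rw [if_neg h, if_neg (fun h' => h ((eq_xor i j m).2 h'))]

/-- Signs and exponents of the Clifford generators. -/
def sgn : Fin 11 → ℤ := ![1, 1, 1, 1, 1, 1, 1, 1, 1, 1, -1]

/-- Exponents of `X`. -/
def xs : Fin 11 → Fin 32 := ![1, 0, 1, 3, 7, 11, 15, 19, 23, 27, 31]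

/-- Exponents of `Z`. -/
def zs : Fin 11 → Fin 32 := ![1, 1, 2, 0, 6, 14, 26, 30, 18, 22, 10]

/-- Explicit real Clifford generators. -/
def gamma (a : Fin 11) : Matrix (Fin 32) (Fin 32) ℝ := (sgn a : ℝ) • pauli (xs a) (zs a)

end Model

open Model in
/-- An explicit real 32-dimensional representation, with spinor metric `Γ_0`. -/
def majoranaModel : MajoranaRep where
  gamma := Model.gamma
  pairing := pauli 1 1
  clifford a b := by
    have h : ∀ a b : Fin 11, sgn a * sgn b * bitSign (zs a &&& xs b) +
        sgn b * sgn a * bitSign (zs b &&& xs a) =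
        2 * (if a = b then (if a = 0 then -1 else 1) else 0) := by decide +kernel
    have h0 : ∀ x : Fin 32, x ^^^ x = 0 := by decide +kernel
    have hab := congrArg (Int.cast : ℤ → ℝ) (h a b)
    push_cast at hab
    simp only [Model.gamma, smul_mul_smul_comm, pauli_mul, smul_smul]
    rw [xor_comm' (xs b), xor_comm' (zs b), ← add_smul, hab, minkowski]
    by_cases hh : a = b
    · subst hh
      rw [h0, h0, pauli_zero]
    · simp [hh]
  volume_eq := by
    have hp : ∀ (s : ℝ) (m z : Fin 32), s = 1 → m = 0 → z = 0 → s • pauli m z = 1 := by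
      rintro s m z rfl rfl rfl
      rw [one_smul, pauli_zero]
    simp only [List.ofFn_succ, List.ofFn_zero, List.prod_cons, List.prod_nil, mul_one,
      Model.gamma, smul_mul_smul_comm, pauli_mul, smul_smul]
    refine hp _ _ _ ?_ (by decide +kernel) (by decide +kernel)
    norm_cast
  pairing_skew := by
    have h : bitSign (1 &&& 1) = -1 := by decide +kernel
    rw [pauli_transpose, h]; simp
  pairing_nondegenerate := by
    have h : bitSign (1 &&& 1) = -1 := by decide +kernel
    have h0 : (1 : Fin 32) ^^^ 1 = 0 := by decide +kernel
    have h1 : pauli 1 1 * -pauli 1 1 = 1 := by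
      rw [mul_neg, pauli_mul, h, h0, pauli_zero]; simp
    exact IsUnit.of_mul_eq_one _ h1
  gamma_skew_adjoint a := by
    have h : ∀ a : Fin 11, sgn a * (bitSign (zs a &&& xs a) * bitSign (zs a &&& 1)) =
        -(sgn a * bitSign (1 &&& xs a)) := by decide +kernel
    have ha := congrArg (Int.cast : ℤ → ℝ) (h a)
    push_cast at ha
    simp only [Model.gamma, Matrix.transpose_smul, pauli_transpose, smul_mul_assoc,
      mul_smul_comm, pauli_mul, smul_smul]
    rw [xor_comm' 1, xor_comm' 1, mul_assoc, ha, neg_smul]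

instance : Nonempty MajoranaRep := ⟨majoranaModel⟩

end SuperIIA

end

/-! Put E = Γ_a e^a, a matrix over the Chevalley–Eilenberg algebra. Skew-symmetrization is automatic
against the anticommuting e^a, so each flux is (1/p!) ψᵀ η E^p A ψ, with η the spinor pairing and A
= 1 or Γ_10 (`flux_eq_sandwich`). Let V = dE = Γ_a (ψ̄ Γ^a ψ) and H = Γ_a (ψ̄ Γ^a Γ_10 ψ). By the
Clifford relation VE + EV and HE + EH are scalar matrices, the latter being 2 H_3^A. Hence, for odd
n, 2 d(E^(n+1)) = (n+1) (V E^n - E^n V) and 2n H_3^A E^(n-1) = H E^n + E^n H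
(`two_smul_derivation_pow`, `smul_mul_pow`). The factorials match, so the recursion says that this
commutator and this anticommutator agree between spinors (`sandwich_commutator_eq`). Their
difference is a sum of left and right multiples of W = V Γ_10 + H, and Wψ = 0 = ψᵀηW.

The identity Wψ = 0 is a cubic Fierz identity. For real spinors (`cubic_eq_zero`), expand the rank
one matrix ψψ̄ in products Γ_J with |J| ≤ 5 (`fierz`) and apply X ↦ ∑ (Γ_a Γ_10 X Γ^a + Γ_a X Γ^a
Γ_10), which sends each Γ_J to a multiple of Γ_J Γ_10. Only J = {b} and J = {b, 10} survive, and
they give back the same cubic: 32 times it equals -16 times it. A polynomial vanishing at all real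
points is zero, so the identity passes to the commuting ψ^α (`cubic_psi_eq_zero`).

The last equation holds because eleven factors e^a drawn from ten generators multiply to zero. -/

namespace SuperIIA

/-! ### Clifford products, their trace orthogonality and the Fierz expansion -/

open Matrix

/-- The trace form separates the characters by which the Clifford generators act. -/
theorem exists_character_ne {I J : Finset (Fin 11)} (hI : I.card ≤ 5) (hJ : J.card ≤ 5)
    (h : I ≠ J) :
    ∃ a, Odd (I.card + (if a ∈ I then 1 else 0) + (J.card + if a ∈ J then 1 else 0)) := by
  have hs : (symmDiff I J).card + 2 * (I ∩ J).card = I.card + J.card := by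
    have h1 : (symmDiff I J).card = (I \ J).card + (J \ I).card :=
      Finset.card_union_of_disjoint disjoint_sdiff_sdiff
    have h2 := Finset.card_sdiff_add_card_inter I J
    have h3 := Finset.card_sdiff_add_card_inter J I
    rw [Finset.inter_comm J I] at h3
    omega
  -- Modulo 2 the required sum is |I ∆ J| + [a ∈ I ∆ J]. In the odd case an index outside I ∆ J
  -- exists because |I ∆ J| ≤ 10 < 11.
  rcases Nat.even_or_odd (symmDiff I J).card with he | ho
  · obtain ⟨a, ha⟩ : (symmDiff I J).Nonempty := by
      rw [Finset.nonempty_iff_ne_empty]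
      intro h0
      exact h (symmDiff_eq_bot.1 h0)
    refine ⟨a, ?_⟩
    rw [Finset.mem_symmDiff] at ha
    rcases ha with ⟨h1, h2⟩ | ⟨h1, h2⟩ <;> simp only [h1, h2, if_true, if_false] <;>
      · obtain ⟨k, hk⟩ := he
        exact ⟨k + (I ∩ J).card, by omega⟩
  · obtain ⟨a, ha⟩ : ∃ a, a ∉ symmDiff I J := by
      by_contra hc
      push Not at hc
      have := Finset.card_le_card (fun a _ => hc a : (Finset.univ : Finset (Fin 11)) ⊆ symmDiff I J)
      simp at this
      omega
    refine ⟨a, ?_⟩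
    rw [Finset.mem_symmDiff] at ha
    obtain ⟨k, hk⟩ := ho
    by_cases h1 : a ∈ I <;> by_cases h2 : a ∈ J <;> simp only [h1, h2, if_true, if_false] <;>
      simp [h1, h2] at ha
    · exact ⟨k + (I ∩ J).card + 1, by omega⟩
    · exact ⟨k + (I ∩ J).card, by omega⟩

/-- Complementation shows that these are half of the 2^11 subsets; 2^10 = 32² is the dimension of
the matrix algebra, which turns independence into spanning. -/
theorem card_small_subsets : Fintype.card {J : Finset (Fin 11) // J.card ≤ 5} = 1024 := by
  rw [Fintype.card_subtype]
  decide +kernel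

theorem minkowski_self_mul_self (a : Fin 11) : minkowski a a * minkowski a a = 1 := by
  unfold minkowski
  split_ifs <;> simp_all

namespace MajoranaRep

variable (M : MajoranaRep)

theorem gammaUp_eq (a : Fin 11) : M.gammaUp a = minkowski a a • M.gamma a := by
  unfold gammaUp
  rw [Finset.sum_eq_single a]
  · intro b _ hb
    simp [minkowski, Ne.symm hb]
  · simp

theorem gamma_mul_self (a : Fin 11) : M.gamma a * M.gamma a = minkowski a a • 1 := by
  have h := M.clifford a a
  rw [← two_smul ℝ, mul_smul] at h
  exact smul_right_injective _ (two_ne_zero (α := ℝ)) h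

theorem gamma_mul_of_ne {a b : Fin 11} (h : a ≠ b) :
    M.gamma a * M.gamma b = -(M.gamma b * M.gamma a) := by
  have := M.clifford a b
  rw [minkowski, if_neg h, mul_zero, zero_smul] at this
  exact eq_neg_of_add_eq_zero_left this

/-- The product of the Clifford generators along a list of indices. -/
def gammaList (l : List (Fin 11)) : Matrix (Fin 32) (Fin 32) ℝ := (l.map M.gamma).prod

theorem gammaList_cons (a : Fin 11) (l : List (Fin 11)) :
    M.gammaList (a :: l) = M.gamma a * M.gammaList l := by
  simp [gammaList]

theorem gammaList_append (l m : List (Fin 11)) :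
    M.gammaList (l ++ m) = M.gammaList l * M.gammaList m := by
  simp [gammaList]

theorem gammaList_singleton (a : Fin 11) : M.gammaList [a] = M.gamma a := by
  simp [gammaList]

/-- Every factor other than Γ_a contributes a sign, and length minus count has the parity of length
plus count. -/
theorem gamma_mul_gammaList (a : Fin 11) (l : List (Fin 11)) :
    M.gamma a * M.gammaList l = (-1 : ℝ) ^ (l.length + l.count a) • (M.gammaList l * M.gamma a) := by
  induction l with
  | nil => simp [gammaList]
  | cons b l ih =>
    rw [gammaList_cons, List.length_cons]
    by_cases h : a = b
    · subst h
      rw [List.count_cons_self]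
      conv_lhs => rw [ih]
      rw [mul_smul_comm, mul_assoc]
      congr 1
      ring
    · rw [List.count_cons_of_ne (Ne.symm h), ← mul_assoc, gamma_mul_of_ne M h, neg_mul, mul_assoc,
        ih, mul_smul_comm, mul_assoc, ← neg_smul]
      congr 1
      ring

theorem gammaList_transpose_mul (l : List (Fin 11)) :
    (M.gammaList l)ᵀ * M.pairing = (-1 : ℝ) ^ l.length • (M.pairing * M.gammaList l.reverse) := by
  induction l with
  | nil => simp [gammaList]
  | cons a l ih =>
    rw [gammaList_cons, transpose_mul, mul_assoc, gamma_skew_adjoint, List.reverse_cons,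
      gammaList_append, gammaList_singleton, mul_neg, ← mul_assoc, ih, List.length_cons, pow_succ,
      mul_neg_one, neg_smul, smul_mul_assoc, mul_assoc]

/-- The square of `gammaList l` up to order reversal. -/
def listSign (l : List (Fin 11)) : ℝ := (l.map fun a => minkowski a a).prod

theorem listSign_mul_self (l : List (Fin 11)) : listSign l * listSign l = 1 := by
  induction l with
  | nil => simp [listSign]
  | cons a l ih =>
    simp only [listSign, List.map_cons, List.prod_cons] at ih ⊢
    rw [mul_mul_mul_comm, ih, minkowski_self_mul_self, mul_one]

theorem gammaList_mul_reverse (l : List (Fin 11)) :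
    M.gammaList l * M.gammaList l.reverse = listSign l • 1 := by
  induction l with
  | nil => simp [gammaList, listSign]
  | cons a l ih =>
    rw [gammaList_cons, List.reverse_cons, gammaList_append, gammaList_singleton, mul_assoc,
      ← mul_assoc (M.gammaList l), ih, smul_mul_assoc, one_mul, mul_smul_comm, gamma_mul_self,
      smul_smul]
    simp [listSign, mul_comm]

/-- Reversal exchanges each pair of distinct, hence anticommuting, factors once. -/
theorem gammaList_reverse {l : List (Fin 11)} (hl : l.Nodup) :
    M.gammaList l.reverse = (-1 : ℝ) ^ (l.length.choose 2) • M.gammaList l := by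
  induction l with
  | nil => simp
  | cons a l ih =>
    rw [List.nodup_cons] at hl
    rw [List.reverse_cons, gammaList_append, gammaList_singleton, ih hl.2, gammaList_cons,
      gamma_mul_gammaList, List.count_eq_zero_of_not_mem hl.1, List.length_cons,
      Nat.choose_succ_succ' _ 1, Nat.choose_one_right, smul_smul, smul_mul_assoc, ← pow_add]
    congr 1
    rw [show l.length + l.length.choose 2 + (l.length + 0) = l.length.choose 2 + 2 * l.length by
      ring, pow_add, pow_mul]
    simp

/-- The ordered product of the Clifford generators with indices in a finite set. -/
def gammaSet (J : Finset (Fin 11)) : Matrix (Fin 32) (Fin 32) ℝ := M.gammaList (J.sort (· ≤ ·))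

/-- The product in the opposite order. -/
def gammaSetRev (J : Finset (Fin 11)) : Matrix (Fin 32) (Fin 32) ℝ :=
  M.gammaList (J.sort (· ≤ ·)).reverse

/-- The sign relating `gammaSetRev` to the inverse of `gammaSet`. -/
def setSign (J : Finset (Fin 11)) : ℝ := listSign (J.sort (· ≤ ·))

theorem count_sort (a : Fin 11) (J : Finset (Fin 11)) :
    (J.sort (· ≤ ·)).count a = if a ∈ J then 1 else 0 := by
  rw [(J.sort_nodup _).count]
  simp

theorem gamma_mul_gammaSet (a : Fin 11) (J : Finset (Fin 11)) :
    M.gamma a * M.gammaSet J =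
      (-1 : ℝ) ^ (J.card + if a ∈ J then 1 else 0) • (M.gammaSet J * M.gamma a) := by
  rw [gammaSet, gamma_mul_gammaList, count_sort, Finset.length_sort]

theorem gamma_mul_gammaSetRev (a : Fin 11) (J : Finset (Fin 11)) :
    M.gamma a * M.gammaSetRev J =
      (-1 : ℝ) ^ (J.card + if a ∈ J then 1 else 0) • (M.gammaSetRev J * M.gamma a) := by
  rw [gammaSetRev, gamma_mul_gammaList, List.count_reverse, count_sort, List.length_reverse,
    Finset.length_sort]

/-- Γ_a² = ±1, and cyclicity of the trace makes tr(Γ_a² X) its own negative. -/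
theorem trace_eq_zero_of_anticomm {X : Matrix (Fin 32) (Fin 32) ℝ} (a : Fin 11)
    (h : M.gamma a * X = -(X * M.gamma a)) : X.trace = 0 := by
  have h1 : (M.gamma a * M.gamma a * X).trace = -(M.gamma a * M.gamma a * X).trace := by
    conv_lhs => rw [mul_assoc, h, mul_neg, trace_neg, ← mul_assoc, trace_mul_comm, ← mul_assoc]
  rw [gamma_mul_self, smul_mul_assoc, one_mul, trace_smul, smul_eq_mul] at h1
  have h2 : minkowski a a * X.trace = 0 := by linarith
  rcases mul_eq_zero.1 h2 with h3 | h3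
  · have := minkowski_self_mul_self a
    rw [h3] at this
    norm_num at this
  · exact h3

/-- For I ≠ J some Γ_a anticommutes with the product, which kills its trace. This orthogonality
provides both the linear independence and the Fierz coefficients. -/
theorem trace_gammaSet_mul_gammaSetRev {I J : Finset (Fin 11)} (hI : I.card ≤ 5)
    (hJ : J.card ≤ 5) :
    (M.gammaSet I * M.gammaSetRev J).trace = if I = J then 32 * setSign J else 0 := by
  split_ifs with h
  · subst h
    rw [gammaSet, gammaSetRev, gammaList_mul_reverse, trace_smul, trace_one]
    simp [setSign, mul_comm]
  · obtain ⟨a, ha⟩ := exists_character_ne hI hJ h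
    refine M.trace_eq_zero_of_anticomm a ?_
    rw [← mul_assoc, gamma_mul_gammaSet, smul_mul_assoc, mul_assoc, gamma_mul_gammaSetRev,
      mul_smul_comm, smul_smul, ← pow_add, ha.neg_one_pow, neg_one_smul, mul_assoc]

theorem setSign_mul_self (J : Finset (Fin 11)) : setSign J * setSign J = 1 := listSign_mul_self _

theorem trace_sum_smul_gammaSet (c : {J : Finset (Fin 11) // J.card ≤ 5} → ℝ)
    (J : {J : Finset (Fin 11) // J.card ≤ 5}) :
    setSign J * ((∑ I, c I • M.gammaSet I) * M.gammaSetRev J).trace = 32 * c J := by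
  simp only [Finset.sum_mul, trace_sum, smul_mul_assoc, trace_smul, smul_eq_mul]
  rw [Finset.sum_eq_single J]
  · rw [M.trace_gammaSet_mul_gammaSetRev J.prop J.prop, if_pos rfl]
    linear_combination (32 * c J) * setSign_mul_self J
  · intro I _ hI
    rw [M.trace_gammaSet_mul_gammaSetRev I.prop J.prop, if_neg (Subtype.coe_injective.ne hI),
      mul_zero]
  · simp

theorem linearIndependent_gammaSet :
    LinearIndependent ℝ fun J : {J : Finset (Fin 11) // J.card ≤ 5} => M.gammaSet J := by
  rw [Fintype.linearIndependent_iff]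
  intro c hc J
  have h := M.trace_sum_smul_gammaSet c J
  rw [hc] at h
  simpa using h.symm

/-- The Fierz expansion of a matrix in antisymmetrized products of at most five generators. -/
theorem fierz (X : Matrix (Fin 32) (Fin 32) ℝ) :
    (32 : ℝ) • X = ∑ J : {J : Finset (Fin 11) // J.card ≤ 5},
      (setSign J * (X * M.gammaSetRev J).trace) • M.gammaSet J := by
  have hX : X ∈ Submodule.span ℝ
      (Set.range fun J : {J : Finset (Fin 11) // J.card ≤ 5} => M.gammaSet J) := by
    rw [M.linearIndependent_gammaSet.span_eq_top_of_card_eq_finrank' (by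
      rw [card_small_subsets]; simp [Module.finrank_matrix])]
    trivial
  obtain ⟨c, rfl⟩ := (Submodule.mem_span_range_iff_exists_fun ℝ).1 hX
  simp only [trace_sum_smul_gammaSet, mul_smul, Finset.smul_sum]

/-- The quadratic form `ψ ↦ (ψ̄ A ψ)` on real spinors. -/
def quad (A : Matrix (Fin 32) (Fin 32) ℝ) (x : Fin 32 → ℝ) : ℝ := x ⬝ᵥ ((M.pairing * A) *ᵥ x)

theorem quad_smul (r : ℝ) (A : Matrix (Fin 32) (Fin 32) ℝ) (x : Fin 32 → ℝ) :
    M.quad (r • A) x = r * M.quad A x := by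
  simp [quad, smul_mulVec]

/-- Since the pairing is skew, its product with a self-adjoint A is a skew matrix, whose quadratic
form vanishes. -/
theorem quad_eq_zero {A : Matrix (Fin 32) (Fin 32) ℝ} (h : Aᵀ * M.pairing = M.pairing * A)
    (x : Fin 32 → ℝ) : M.quad A x = 0 := by
  have h1 : (M.pairing * A)ᵀ = -(M.pairing * A) := by
    rw [transpose_mul, pairing_skew, mul_neg, h]
  have h2 : M.quad A x = -M.quad A x := by
    conv_lhs => rw [quad, dotProduct_comm, ← vecMul_transpose, h1, ← dotProduct_mulVec]
    rw [neg_mulVec, dotProduct_neg, quad]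
  linarith

/-- The adjoint of a product of k distinct generators carries the sign (-1)^(k + k(k-1)/2), which is
+1 for k = 3 and k = 4. -/
theorem quad_gammaSetRev_eq_zero {J : Finset (Fin 11)} (h : J.card = 3 ∨ J.card = 4)
    (x : Fin 32 → ℝ) : M.quad (M.gammaSetRev J) x = 0 := by
  apply quad_eq_zero
  rw [gammaSetRev, gammaList_transpose_mul, List.reverse_reverse,
    M.gammaList_reverse (J.sort_nodup _), List.length_reverse, Finset.length_sort, mul_smul_comm]
  rcases h with h | h <;> rw [h] <;> norm_num [Nat.choose]

end MajoranaRep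

end SuperIIA

/-! ### The cubic Fierz identity for real spinors -/

namespace SuperIIA

open Matrix

/-- The coefficient `ω` in `∑_{a < 10} Γ_a Γ_J Γ^a = ω Γ_J`, times the factor `σ` in
`[Γ_J, Γ_10] = σ Γ_J Γ_10`. -/
def fierzWeight (J : Finset (Fin 11)) : ℤ :=
  (∑ a : Fin 10, (-1) ^ (J.card + if a.castSucc ∈ J then 1 else 0)) *
    (1 - (-1) ^ (J.card + if (10 : Fin 11) ∈ J then 1 else 0))

/-- Sizes 3 and 4 are excluded because their bilinears vanish anyway. Of the rest, ∅, {10}, pairs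
avoiding 10 and quintuples containing 10 commute with Γ_10; for quintuples avoiding 10, the sum over
a has five terms of each sign. -/
theorem fierzWeight_ne_zero : ∀ J : Finset (Fin 11), J.card ≤ 5 →
    (∀ b : Fin 10, J ≠ {b.castSucc}) → (∀ b : Fin 10, J ≠ {b.castSucc, 10}) →
    J.card ≠ 3 → J.card ≠ 4 → fierzWeight J = 0 := by
  decide +kernel

theorem fierzWeight_singleton : ∀ b : Fin 10, fierzWeight {b.castSucc} = -16 := by
  decide +kernel

theorem fierzWeight_pair : ∀ b : Fin 10, fierzWeight {b.castSucc, 10} = 16 := by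
  decide +kernel

theorem sort_pair (b : Fin 10) :
    ({b.castSucc, 10} : Finset (Fin 11)).sort (· ≤ ·) = [b.castSucc, 10] := by
  rw [Finset.sort_insert, Finset.sort_singleton]
  · intro c hc
    rw [Finset.mem_singleton.1 hc]
    exact Fin.le_last _
  · revert b
    decide

/-- Sums over the small sets of indices that are supported on the two relevant families. -/
theorem sum_small_subsets {A : Type*} [AddCommMonoid A] (f : Finset (Fin 11) → A)
    (hf : ∀ J : Finset (Fin 11), J.card ≤ 5 →
      (∀ b : Fin 10, J ≠ {b.castSucc}) → (∀ b : Fin 10, J ≠ {b.castSucc, 10}) → f J = 0) :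
    ∑ J : {J : Finset (Fin 11) // J.card ≤ 5}, f J =
      ∑ b : Fin 10, (f {b.castSucc} + f {b.castSucc, 10}) := by
  have hinj1 : Function.Injective fun b : Fin 10 => ({b.castSucc} : Finset (Fin 11)) := by
    decide +kernel
  have hinj2 : Function.Injective fun b : Fin 10 => ({b.castSucc, 10} : Finset (Fin 11)) := by
    decide +kernel
  have hdisj : Disjoint (Finset.univ.image fun b : Fin 10 => ({b.castSucc} : Finset (Fin 11)))
      (Finset.univ.image fun b : Fin 10 => ({b.castSucc, 10} : Finset (Fin 11))) := by
    decide +kernel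
  rw [Finset.sum_add_distrib, ← Finset.sum_image (f := f) (fun _ _ _ _ h => hinj1 h),
    ← Finset.sum_image (f := f) (fun _ _ _ _ h => hinj2 h), ← Finset.sum_union hdisj,
    ← Finset.sum_subtype (Finset.univ.filter fun J : Finset (Fin 11) => J.card ≤ 5) (by simp) f]
  symm
  apply Finset.sum_subset
  · intro J hJ
    simp only [Finset.mem_union, Finset.mem_image, Finset.mem_univ, true_and] at hJ
    simp only [Finset.mem_filter, Finset.mem_univ, true_and]
    rcases hJ with ⟨b, rfl⟩ | ⟨b, rfl⟩
    · simp
    · exact Finset.card_le_two.trans (by norm_num)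
  · intro J hJ hJ'
    simp only [Finset.mem_union, Finset.mem_image, Finset.mem_univ, true_and, not_or,
      not_exists] at hJ'
    exact hf J (by simpa using hJ) (fun b h => hJ'.1 b h.symm) (fun b h => hJ'.2 b h.symm)

namespace MajoranaRep

variable (M : MajoranaRep)

theorem gamma_ten_mul_self : M.gamma 10 * M.gamma 10 = 1 := by
  rw [gamma_mul_self]
  simp [minkowski]

theorem gamma_ten_mul (a : Fin 10) :
    M.gamma 10 * M.gamma a.castSucc = -(M.gamma a.castSucc * M.gamma 10) :=
  M.gamma_mul_of_ne (by revert a; decide)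

/-- The rank one endomorphism `φ ↦ ψ (ψ̄ φ)`. -/
def rankOne (x : Fin 32 → ℝ) : Matrix (Fin 32) (Fin 32) ℝ := vecMulVec x (x ᵥ* M.pairing)

theorem trace_rankOne_mul (x : Fin 32 → ℝ) (A : Matrix (Fin 32) (Fin 32) ℝ) :
    (M.rankOne x * A).trace = M.quad A x := by
  rw [rankOne, vecMulVec_mul, trace_vecMulVec, vecMul_vecMul, quad, dotProduct_mulVec,
    dotProduct_comm]

theorem rankOne_mul_mulVec (x : Fin 32 → ℝ) (A : Matrix (Fin 32) (Fin 32) ℝ) :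
    (M.rankOne x * A) *ᵥ x = M.quad A x • x := by
  rw [rankOne, vecMulVec_mul, vecMulVec_mulVec, vecMul_vecMul, quad, dotProduct_mulVec]
  ext i
  simp [mul_comm]

/-- The linear map `X ↦ ∑_{a < 10} (Γ_a Γ_10 X Γ^a + Γ_a X Γ^a Γ_10)`. -/
def sandwichSum (X : Matrix (Fin 32) (Fin 32) ℝ) : Matrix (Fin 32) (Fin 32) ℝ :=
  ∑ a : Fin 10, minkowski a.castSucc a.castSucc •
    (M.gamma a.castSucc * M.gamma 10 * X * M.gamma a.castSucc +
      M.gamma a.castSucc * X * (M.gamma a.castSucc * M.gamma 10))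

theorem sandwichSum_smul (r : ℝ) (X : Matrix (Fin 32) (Fin 32) ℝ) :
    M.sandwichSum (r • X) = r • M.sandwichSum X := by
  simp only [sandwichSum, mul_smul_comm, smul_mul_assoc, ← smul_add, Finset.smul_sum,
    smul_comm r]

theorem sandwichSum_sum {κ : Type*} (s : Finset κ) (X : κ → Matrix (Fin 32) (Fin 32) ℝ) :
    M.sandwichSum (∑ k ∈ s, X k) = ∑ k ∈ s, M.sandwichSum (X k) := by
  simp only [sandwichSum, Finset.mul_sum, Finset.sum_mul, ← Finset.sum_add_distrib,
    Finset.smul_sum]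
  exact Finset.sum_comm

/-- Moving Γ_a through Γ_J gives a sign and leaves Γ_a Γ^a = 1. The two summands then differ by the
sign of moving Γ_10 through Γ_J and by the one from Γ_a Γ_10 = -Γ_10 Γ_a. -/
theorem sandwichSum_gammaSet (J : Finset (Fin 11)) :
    M.sandwichSum (M.gammaSet J) = (fierzWeight J : ℝ) • (M.gammaSet J * M.gamma 10) := by
  have h (a : Fin 10) : minkowski a.castSucc a.castSucc •
      (M.gamma a.castSucc * M.gamma 10 * M.gammaSet J * M.gamma a.castSucc +
        M.gamma a.castSucc * M.gammaSet J * (M.gamma a.castSucc * M.gamma 10)) =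
      ((-1 : ℝ) ^ (J.card + if a.castSucc ∈ J then 1 else 0) *
        (1 - (-1) ^ (J.card + if (10 : Fin 11) ∈ J then 1 else 0))) •
        (M.gammaSet J * M.gamma 10) := by
    set s : ℝ := (-1 : ℝ) ^ (J.card + if a.castSucc ∈ J then 1 else 0) with hs
    set t : ℝ := (-1 : ℝ) ^ (J.card + if (10 : Fin 11) ∈ J then 1 else 0) with ht
    have h1 : M.gamma a.castSucc * M.gammaSet J = s • (M.gammaSet J * M.gamma a.castSucc) :=
      M.gamma_mul_gammaSet _ _
    have h2 : M.gamma 10 * M.gammaSet J = t • (M.gammaSet J * M.gamma 10) :=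
      M.gamma_mul_gammaSet _ _
    have h3 : M.gamma a.castSucc * M.gammaSet J * M.gamma a.castSucc =
        (s * minkowski a.castSucc a.castSucc) • M.gammaSet J := by
      rw [h1, smul_mul_assoc, mul_assoc, gamma_mul_self, mul_smul_comm, mul_one, smul_smul]
    have h4 : M.gamma a.castSucc * M.gamma 10 = -(M.gamma 10 * M.gamma a.castSucc) := by
      rw [gamma_ten_mul, neg_neg]
    have h5 : M.gamma a.castSucc * M.gamma 10 * M.gammaSet J * M.gamma a.castSucc =
        -((s * minkowski a.castSucc a.castSucc * t) • (M.gammaSet J * M.gamma 10)) := by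
      rw [h4, neg_mul, neg_mul, mul_assoc, mul_assoc, ← mul_assoc (M.gamma a.castSucc), h3,
        mul_smul_comm, h2, smul_smul]
    rw [h5, ← mul_assoc, h3, smul_mul_assoc, ← neg_smul, ← add_smul, smul_smul]
    congr 1
    linear_combination (s - s * t) * minkowski_self_mul_self a.castSucc
  rw [sandwichSum, Finset.sum_congr rfl fun a _ => h a, ← Finset.sum_smul, ← Finset.sum_mul,
    fierzWeight]
  push_cast
  rfl

/-- The cubic Fierz expression `(ψ̄ Γ^a ψ) Γ_a Γ_10 ψ + (ψ̄ Γ^a Γ_10 ψ) Γ_a ψ`. -/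
def cubic (x : Fin 32 → ℝ) : Fin 32 → ℝ :=
  ∑ a : Fin 10, minkowski a.castSucc a.castSucc •
    (M.quad (M.gamma a.castSucc) x • ((M.gamma a.castSucc * M.gamma 10) *ᵥ x) +
      M.quad (M.gamma a.castSucc * M.gamma 10) x • (M.gamma a.castSucc *ᵥ x))

theorem sandwichSum_rankOne (x : Fin 32 → ℝ) :
    M.sandwichSum (M.rankOne x) *ᵥ x = M.cubic x := by
  rw [sandwichSum, cubic, sum_mulVec]
  refine Finset.sum_congr rfl fun a _ => ?_
  rw [smul_mulVec, add_mulVec, mul_assoc (_ * _), mul_assoc (M.gamma _) (M.rankOne x),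
    ← mulVec_mulVec _ _ (_ * M.gamma _), rankOne_mul_mulVec, mulVec_smul,
    ← mulVec_mulVec x (M.gamma _) (M.rankOne x * _), rankOne_mul_mulVec, mulVec_smul]

/-- The Fierz expansion of the rank one matrix of x, pushed through `sandwichSum` and applied to x,
reproduces the cubic itself with a different factor. -/
theorem cubic_eq_zero (x : Fin 32 → ℝ) : M.cubic x = 0 := by
  have h := congrArg (fun X => M.sandwichSum X *ᵥ x) (M.fierz (M.rankOne x))
  simp only [sandwichSum_smul, sandwichSum_sum, trace_rankOne_mul, sandwichSum_gammaSet] at h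
  rw [smul_mulVec, sandwichSum_rankOne, sum_small_subsets (fun J =>
    (setSign J * M.quad (M.gammaSetRev J) x) • (fierzWeight J : ℝ) •
      (M.gammaSet J * M.gamma 10))] at h
  · have h1 (b : Fin 10) : (setSign {b.castSucc} * M.quad (M.gammaSetRev {b.castSucc}) x) •
        (fierzWeight {b.castSucc} : ℝ) • (M.gammaSet {b.castSucc} * M.gamma 10) =
        (-16 * minkowski b.castSucc b.castSucc * M.quad (M.gamma b.castSucc) x) •
          (M.gamma b.castSucc * M.gamma 10) := by
      rw [fierzWeight_singleton, setSign, gammaSetRev, gammaSet, Finset.sort_singleton,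
        List.reverse_singleton, gammaList_singleton, smul_smul]
      congr 1
      simp [listSign]
      ring
    have h2 (b : Fin 10) :
        (setSign {b.castSucc, 10} * M.quad (M.gammaSetRev {b.castSucc, 10}) x) •
        (fierzWeight {b.castSucc, 10} : ℝ) • (M.gammaSet {b.castSucc, 10} * M.gamma 10) =
        (-16 * minkowski b.castSucc b.castSucc * M.quad (M.gamma b.castSucc * M.gamma 10) x) •
          M.gamma b.castSucc := by
      -- The sign from reversing the pair turns its weight 16 into -16, matching the singletons.
      have h3 : M.gammaList [10, b.castSucc] = (-1 : ℝ) • (M.gamma b.castSucc * M.gamma 10) := by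
        rw [gammaList_cons, gammaList_singleton, gamma_ten_mul, neg_one_smul]
      rw [fierzWeight_pair, setSign, gammaSetRev, gammaSet, sort_pair,
        show [b.castSucc, 10].reverse = [10, b.castSucc] from rfl, h3, gammaList_cons,
        gammaList_singleton, mul_assoc, gamma_ten_mul_self, mul_one, quad_smul, smul_smul]
      congr 1
      have h5 : minkowski 10 10 = 1 := by simp [minkowski]
      simp only [listSign, List.map_cons, List.map_nil, List.prod_cons, List.prod_nil, h5]
      push_cast
      ring
    simp only [h1, h2] at h
    have h4 : (∑ b : Fin 10, ((-16 * minkowski b.castSucc b.castSucc *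
        M.quad (M.gamma b.castSucc) x) • (M.gamma b.castSucc * M.gamma 10) +
        (-16 * minkowski b.castSucc b.castSucc * M.quad (M.gamma b.castSucc * M.gamma 10) x) •
          M.gamma b.castSucc)) *ᵥ x = (-16 : ℝ) • M.cubic x := by
      rw [sum_mulVec, cubic, Finset.smul_sum]
      refine Finset.sum_congr rfl fun b _ => ?_
      rw [add_mulVec, smul_mulVec, smul_mulVec]
      module
    -- The total factor is 32 - (-16) = 48, which is nonzero.
    rw [h4, ← sub_eq_zero, ← sub_smul] at h
    exact (smul_eq_zero.1 h).resolve_left (by norm_num)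
  · intro J hJ h1 h2
    by_cases h3 : J.card = 3 ∨ J.card = 4
    · rw [quad_gammaSetRev_eq_zero M h3, mul_zero, zero_smul]
    · rw [not_or] at h3
      rw [fierzWeight_ne_zero J hJ h1 h2 h3.1 h3.2, Int.cast_zero, zero_smul, smul_zero]

end MajoranaRep

end SuperIIA

/-! ### Powers of an odd element, and products of the generators ψ and e -/

namespace SuperIIA

open Matrix

section OddPowers

variable {R : Type*} [Ring R] [Algebra ℝ R] {E V H : R}

theorem pow_mul_of_anticomm (hH : E * H = -(H * E)) (m : ℕ) :
    E ^ m * H = (-1 : ℝ) ^ m • (H * E ^ m) := by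
  induction m with
  | zero => simp
  | succ m ih =>
    rw [pow_succ, mul_assoc, hH, mul_neg, ← mul_assoc, ih, pow_succ, mul_neg_one, neg_smul,
      smul_mul_assoc, mul_assoc]

/-- Contraction of a power of the odd element `E` as a graded commutator. -/
theorem smul_mul_pow (hV : V * E + E * V = (2 : ℝ) • H) (hH : E * H = -(H * E)) (m : ℕ) :
    (2 * ((m : ℝ) + 1)) • (H * E ^ m) =
      V * E ^ (m + 1) - (-1 : ℝ) ^ (m + 1) • (E ^ (m + 1) * V) := by
  induction m with
  | zero => simpa using hV.symm
  | succ m ih =>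
    have h1 : V * E ^ (m + 1) =
        (2 * ((m : ℝ) + 1)) • (H * E ^ m) + (-1 : ℝ) ^ (m + 1) • (E ^ (m + 1) * V) := by
      rw [ih]; abel
    have h2 : V * E = (2 : ℝ) • H - E * V := eq_sub_of_add_eq hV
    rw [pow_succ E (m + 1), ← mul_assoc V, h1, add_mul, smul_mul_assoc, mul_assoc H, ← pow_succ,
      smul_mul_assoc, mul_assoc _ V, h2, mul_sub, mul_smul_comm, pow_mul_of_anticomm hH,
      ← mul_assoc, pow_succ (-1 : ℝ) (m + 1)]
    have h3 : (-1 : ℝ) ^ (m + 1) * (-1) ^ (m + 1) = 1 := by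
      rw [← mul_pow]; simp
    rw [smul_sub, smul_comm (2 : ℝ), smul_smul ((-1 : ℝ) ^ (m + 1)), h3]
    push_cast
    module

/-- A graded derivation of a power of the odd element `E` as a graded anticommutator. -/
theorem two_smul_derivation_pow (hV : V * E + E * V = (2 : ℝ) • H) (hH : E * H = -(H * E))
    {D : ℕ → R} (h0 : D 0 = 0) (hD : ∀ k, D (k + 1) = D k * E + (-1 : ℝ) ^ k • (E ^ k * V))
    (m : ℕ) :
    (2 : ℝ) • D (m + 1) = ((m : ℝ) + 1) • (V * E ^ m + (-1 : ℝ) ^ m • (E ^ m * V)) := by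
  induction m with
  | zero => rw [hD, h0]; simp [two_smul]
  | succ m ih =>
    have h1 := smul_mul_pow hV hH m
    have h2 : V * E = (2 : ℝ) • H - E * V := eq_sub_of_add_eq hV
    have h2' : E * V = (2 : ℝ) • H - V * E := eq_sub_of_add_eq' hV
    have h3 : E ^ m * V * E = (2 * (-1 : ℝ) ^ m) • (H * E ^ m) - E ^ (m + 1) * V := by
      rw [mul_assoc, h2, mul_sub, mul_smul_comm, pow_mul_of_anticomm hH, smul_smul, ← mul_assoc,
        ← pow_succ]
    have h4 : (-1 : ℝ) ^ m * (-1) ^ m = 1 := by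
      rw [← mul_pow]; simp
    have h5 : (2 * ((m : ℝ) + 1)) • (H * E ^ m) =
        V * E ^ (m + 1) + (-1 : ℝ) ^ m • (E ^ (m + 1) * V) := by
      rw [h1, pow_succ (-1 : ℝ)]; module
    rw [hD, smul_add, ← smul_mul_assoc, ih, smul_mul_assoc, add_mul, mul_assoc, ← pow_succ,
      smul_mul_assoc, h3, smul_sub, smul_smul,
      show (-1 : ℝ) ^ m * (2 * (-1) ^ m) = 2 by linear_combination 2 * h4, smul_add, smul_sub,
      smul_smul ((m : ℝ) + 1) 2, mul_comm ((m : ℝ) + 1) 2, h5]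
    rw [pow_succ (-1 : ℝ)]
    push_cast
    module

end OddPowers

namespace CE

open scoped IsMulCommutative in
/-- A cubic polynomial in the commuting generators `ψ` that vanishes at all real points
vanishes in the Chevalley–Eilenberg algebra. -/
theorem cubic_psi_eq_zero (t : Fin 32 → Fin 32 → Fin 32 → ℝ)
    (h : ∀ x : Fin 32 → ℝ, ∑ i, ∑ j, ∑ k, t i j k * (x i * x j * x k) = 0) :
    ∑ i, ∑ j, ∑ k, t i j k • (psi i * psi j * psi k) = 0 := by
  -- Polynomial evaluation needs a commutative target, which the subalgebra generated by the ψ^α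
  -- provides.
  let S := Algebra.adjoin ℝ (Set.range psi)
  have : IsMulCommutative S := Algebra.isMulCommutative_adjoin ℝ (by
    rintro _ ⟨i, rfl⟩ _ ⟨j, rfl⟩
    exact psi_psi i j)
  let y : Fin 32 → S := fun i => ⟨psi i, Algebra.subset_adjoin ⟨i, rfl⟩⟩
  let P : MvPolynomial (Fin 32) ℝ := ∑ i, ∑ j, ∑ k, t i j k •
    (MvPolynomial.X i * MvPolynomial.X j * MvPolynomial.X k)
  have hP : P = 0 := by
    apply MvPolynomial.funext
    intro x
    simpa [P, MvPolynomial.smul_eval] using h x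
  have h1 := congrArg (fun Q => S.val (MvPolynomial.aeval y Q)) hP
  simpa [P, y] using h1

/-- The inclusion of the exterior algebra on the bosonic generators. -/
def exteriorMap : ExteriorAlgebra ℝ (Fin 10 → ℝ) →ₐ[ℝ] CE :=
  ExteriorAlgebra.lift ℝ ⟨Fintype.linearCombination ℝ e, fun v => by
    simp only [Fintype.linearCombination_apply, Finset.sum_mul, Finset.mul_sum, smul_mul_smul_comm]
    have h : ∑ a, ∑ b, (v a * v b) • (e a * e b) = -∑ a, ∑ b, (v a * v b) • (e a * e b) := by
      conv_lhs => rw [Finset.sum_comm]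
      simp only [← Finset.sum_neg_distrib, ← smul_neg]
      refine Finset.sum_congr rfl fun a _ => Finset.sum_congr rfl fun b _ => ?_
      rw [e_e b a, mul_comm]
    have h2 : (2 : ℝ) • ∑ a, ∑ b, (v a * v b) • (e a * e b) = 0 := by
      rw [two_smul]
      nth_rewrite 1 [h]
      simp
    rw [Finset.sum_comm]
    exact (smul_eq_zero.1 h2).resolve_left two_ne_zero⟩

/-- Lets products of the e^a inherit permutation signs and vanishing on repeated indices from the
alternating map `ExteriorAlgebra.ιMulti`. -/
theorem prod_e_eq {p : ℕ} (a : Fin p → Fin 10) :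
    (List.ofFn fun i => e (a i)).prod =
      exteriorMap (ExteriorAlgebra.ιMulti ℝ p fun i => Pi.single (a i) 1) := by
  rw [ExteriorAlgebra.ιMulti_apply, map_list_prod, List.map_ofFn]
  congr 2
  ext i
  simp [exteriorMap]

theorem prod_e_perm {p : ℕ} (a : Fin p → Fin 10) (σ : Equiv.Perm (Fin p)) :
    (List.ofFn fun i => e (a (σ i))).prod =
      ((Equiv.Perm.sign σ : ℤ) : ℝ) • (List.ofFn fun i => e (a i)).prod := by
  rw [prod_e_eq, prod_e_eq, ← map_smul]
  congr 1
  have h := (ExteriorAlgebra.ιMulti ℝ p).map_perm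
    (fun i => (Pi.single (a i) 1 : Fin 10 → ℝ)) σ
  rw [Int.cast_smul_eq_zsmul]
  exact h

theorem prod_e_eq_zero (a : Fin 11 → Fin 10) : (List.ofFn fun i => e (a i)).prod = 0 := by
  obtain ⟨i, j, hij, h⟩ := Fintype.exists_ne_map_eq_of_card_lt a (by simp)
  rw [prod_e_eq, (ExteriorAlgebra.ιMulti ℝ 11).map_eq_zero_of_eq _ (by rw [h]) hij, map_zero]

theorem prod_e_psi {p : ℕ} (hp : Even p) (a : Fin p → Fin 10) (α : Fin 32) :
    (List.ofFn fun i => e (a i)).prod * psi α = psi α * (List.ofFn fun i => e (a i)).prod := by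
  have h (l : List (Fin 10)) :
      (l.map e).prod * psi α = (-1 : ℝ) ^ l.length • (psi α * (l.map e).prod) := by
    induction l with
    | nil => simp
    | cons b l ih =>
      rw [List.map_cons, List.prod_cons, mul_assoc, ih, mul_smul_comm, ← mul_assoc, e_psi,
        List.length_cons, pow_succ, mul_neg_one, neg_smul, neg_mul, smul_neg, mul_assoc]
  have h1 := h (List.ofFn a)
  rwa [List.map_ofFn, List.length_ofFn, hp.neg_one_pow, one_smul] at h1

end CE

theorem sum_pow_eq_sum_ofFn {R κ : Type*} [Semiring R] [Fintype κ] (x : κ → R) (p : ℕ) :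
    (∑ k, x k) ^ p = ∑ a : Fin p → κ, (List.ofFn fun i => x (a i)).prod := by
  induction p with
  | zero => simp
  | succ p ih =>
    rw [pow_succ', ih, Finset.sum_mul_sum, ← Fintype.sum_prod_type',
      ← (Fin.consEquiv fun _ : Fin (p + 1) => κ).sum_comp]
    refine Finset.sum_congr rfl fun ⟨k, a⟩ _ => ?_
    simp [List.ofFn_succ, Fin.consEquiv]

end SuperIIA

/-! ### Spinor matrices over the Chevalley–Eilenberg algebra and the fluxes as sandwiches -/

namespace SuperIIA

open Matrix CE

/-- Real matrices as matrices over the Chevalley–Eilenberg algebra. -/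
def emb : Matrix (Fin 32) (Fin 32) ℝ →ₐ[ℝ] Matrix (Fin 32) (Fin 32) CE :=
  (Algebra.ofId ℝ CE).mapMatrix

theorem emb_apply (A : Matrix (Fin 32) (Fin 32) ℝ) (i j : Fin 32) :
    emb A i j = algebraMap ℝ CE (A i j) := rfl

/-- Scalar matrices over the Chevalley–Eilenberg algebra. -/
def scal : CE →+* Matrix (Fin 32) (Fin 32) CE := Matrix.scalar (Fin 32)

theorem scal_mul_apply (x : CE) (X : Matrix (Fin 32) (Fin 32) CE) (i j : Fin 32) :
    (scal x * X) i j = x * X i j := by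
  simp [scal, Matrix.scalar_apply]

theorem mul_scal_apply (x : CE) (X : Matrix (Fin 32) (Fin 32) CE) (i j : Fin 32) :
    (X * scal x) i j = X i j * x := by
  simp [scal, Matrix.scalar_apply]

theorem scal_smul (r : ℝ) (x : CE) : scal (r • x) = r • scal x := by
  ext i j
  have h := mul_scal_apply (r • x) 1 i j
  have h' := mul_scal_apply x 1 i j
  rw [one_mul] at h h'
  rw [h, Matrix.smul_apply, h', mul_smul_comm]

theorem scal_mul_emb (x : CE) (A : Matrix (Fin 32) (Fin 32) ℝ) :
    scal x * emb A = emb A * scal x := by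
  ext i j
  rw [scal_mul_apply, mul_scal_apply, emb_apply, Algebra.commutes]

theorem emb_mul_scal_mul (A B : Matrix (Fin 32) (Fin 32) ℝ) (x y : CE) :
    (emb A * scal x) * (emb B * scal y) = emb (A * B) * scal (x * y) := by
  rw [mul_assoc, ← mul_assoc (scal x), scal_mul_emb, map_mul, map_mul]
  simp only [mul_assoc]

/-- The contraction `∑_a g_a c_a` of a family of spinor matrices. -/
def slash (g : Fin 10 → Matrix (Fin 32) (Fin 32) ℝ) (c : Fin 10 → CE) :
    Matrix (Fin 32) (Fin 32) CE := ∑ a, emb (g a) * scal (c a)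

/-- The expression `ψ^α X_{αβ} ψ^β`. -/
def sandwich (X : Matrix (Fin 32) (Fin 32) CE) : CE := psi ⬝ᵥ (X *ᵥ psi)

theorem sandwich_add (X Y : Matrix (Fin 32) (Fin 32) CE) :
    sandwich (X + Y) = sandwich X + sandwich Y := by
  rw [sandwich, add_mulVec, dotProduct_add]; rfl

theorem sandwich_neg (X : Matrix (Fin 32) (Fin 32) CE) : sandwich (-X) = -sandwich X := by
  rw [sandwich, neg_mulVec, dotProduct_neg]; rfl

theorem sandwich_smul (r : ℝ) (X : Matrix (Fin 32) (Fin 32) CE) :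
    sandwich (r • X) = r • sandwich X := by
  rw [sandwich, smul_mulVec, dotProduct_smul]; rfl

theorem sandwich_sum {κ : Type*} (s : Finset κ) (X : κ → Matrix (Fin 32) (Fin 32) CE) :
    sandwich (∑ k ∈ s, X k) = ∑ k ∈ s, sandwich (X k) := by
  simp only [sandwich, sum_mulVec, dotProduct_sum]

theorem sandwich_mul_of_mulVec_eq_zero {W : Matrix (Fin 32) (Fin 32) CE} (h : W *ᵥ psi = 0)
    (X : Matrix (Fin 32) (Fin 32) CE) : sandwich (X * W) = 0 := by
  rw [sandwich, ← mulVec_mulVec, h, mulVec_zero, dotProduct_zero]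

theorem sandwich_mul_of_vecMul_eq_zero {W : Matrix (Fin 32) (Fin 32) CE} (h : psi ᵥ* W = 0)
    (X : Matrix (Fin 32) (Fin 32) CE) : sandwich (W * X) = 0 := by
  rw [sandwich, ← mulVec_mulVec, dotProduct_mulVec, h, zero_dotProduct]

/-- The sign comes from crossing the left-hand ψ only. -/
theorem mul_sandwich {x : CE} (hx : ∀ α, x * psi α = -(psi α * x))
    (X : Matrix (Fin 32) (Fin 32) CE) : x * sandwich X = -sandwich (scal x * X) := by
  simp only [sandwich, dotProduct, mulVec, scal_mul_apply, Finset.mul_sum,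
    ← Finset.sum_neg_distrib]
  refine Finset.sum_congr rfl fun i _ => Finset.sum_congr rfl fun j _ => ?_
  rw [← mul_assoc, hx]
  simp only [neg_mul, mul_assoc]

namespace MajoranaRep

variable (M : MajoranaRep)

/-- Bilinears have bidegree (2, even), so they are central; it suffices to check this on generators.
-/
theorem mul_bilinear_comm (x : CE) (A : Matrix (Fin 32) (Fin 32) ℝ) :
    x * M.bilinear A = M.bilinear A * x := by
  induction x using CE.induction with
  | halg r => exact Algebra.commutes r _
  | hgen x => cases x with
    | psi α => exact M.psi_bilinear α A
    | e a => exact M.e_bilinear a A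
  | hadd x y hx hy => rw [add_mul, mul_add, hx, hy]
  | hmul x y hx hy => rw [mul_assoc, hy, ← mul_assoc, hx, mul_assoc]

theorem bilinear_smul (r : ℝ) (A : Matrix (Fin 32) (Fin 32) ℝ) :
    M.bilinear (r • A) = r • M.bilinear A := by
  simp only [bilinear, mul_smul_comm, Matrix.smul_apply, smul_assoc, Finset.smul_sum]

theorem bilinear_sum {κ : Type*} (s : Finset κ) (A : κ → Matrix (Fin 32) (Fin 32) ℝ) :
    M.bilinear (∑ k ∈ s, A k) = ∑ k ∈ s, M.bilinear (A k) := by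
  simp only [bilinear, Finset.mul_sum, Matrix.sum_apply, Finset.sum_smul]
  rw [Finset.sum_comm' (t' := Finset.univ) (s' := fun _ => s) (by simp [and_comm])]
  refine Finset.sum_congr rfl fun α _ => ?_
  exact Finset.sum_comm

/-- The Clifford generators in ten dimensions. -/
def gammaTen (a : Fin 10) : Matrix (Fin 32) (Fin 32) ℝ := M.gamma a.castSucc

/-- The matrix `Γ_a e^a`. -/
def eMat : Matrix (Fin 32) (Fin 32) CE := slash M.gammaTen e

/-- The matrix `Γ_a (ψ̄ Γ^a ψ)`. -/
def vMat : Matrix (Fin 32) (Fin 32) CE :=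
  slash M.gammaTen fun a => M.bilinear (M.gammaUp a.castSucc)

/-- The matrix `Γ_a (ψ̄ Γ^a Γ_10 ψ)`. -/
def hMat : Matrix (Fin 32) (Fin 32) CE :=
  slash M.gammaTen fun a => M.bilinear (M.gammaUp a.castSucc * M.gamma 10)

theorem eMat_pow (p : ℕ) : M.eMat ^ p = ∑ a : Fin p → Fin 10,
    emb (List.ofFn fun i => M.gamma (a i).castSucc).prod *
      scal (List.ofFn fun i => e (a i)).prod := by
  rw [eMat, slash, sum_pow_eq_sum_ofFn]
  refine Finset.sum_congr rfl fun a _ => ?_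
  have h (l : List (Fin 10)) : (l.map fun a => emb (M.gammaTen a) * scal (e a)).prod =
      emb (l.map fun a => M.gamma a.castSucc).prod * scal (l.map e).prod := by
    induction l with
    | nil => simp
    | cons b l ih => simp only [List.map_cons, List.prod_cons, ih, emb_mul_scal_mul]; rfl
  have h1 := h (List.ofFn a)
  rw [List.map_ofFn, List.map_ofFn, List.map_ofFn] at h1
  exact h1

theorem sandwich_emb_mul_scal {w : CE} (hw : ∀ α, w * psi α = psi α * w)
    (A : Matrix (Fin 32) (Fin 32) ℝ) :
    sandwich (emb M.pairing * (emb A * scal w)) = M.bilinear A * w := by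
  rw [← mul_assoc, ← map_mul]
  simp only [sandwich, dotProduct, mulVec, mul_scal_apply, emb_apply, bilinear, Finset.mul_sum,
    Finset.sum_mul]
  refine Finset.sum_congr rfl fun i _ => Finset.sum_congr rfl fun j _ => ?_
  rw [mul_assoc (algebraMap _ _ _), hw, ← Algebra.smul_def, mul_smul_comm, smul_mul_assoc,
    mul_assoc]

/-- Skew-symmetrization of the Clifford generators is redundant in the flux densities. -/
theorem flux_eq_sandwich {p : ℕ} (hp : Even p) (A : Matrix (Fin 32) (Fin 32) ℝ) :
    M.flux p A = ((p.factorial : ℝ)⁻¹) •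
      sandwich (emb M.pairing * (M.eMat ^ p * emb A)) := by
  have h1 : sandwich (emb M.pairing * (M.eMat ^ p * emb A)) = ∑ a : Fin p → Fin 10,
      M.bilinear ((List.ofFn fun i => M.gamma (a i).castSucc).prod * A) *
        (List.ofFn fun i => e (a i)).prod := by
    rw [eMat_pow, Finset.sum_mul, Finset.mul_sum, sandwich_sum]
    refine Finset.sum_congr rfl fun a _ => ?_
    rw [mul_assoc (emb (List.prod _)), scal_mul_emb, ← mul_assoc (emb (List.prod _)), ← map_mul,
      sandwich_emb_mul_scal M (prod_e_psi hp a)]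
  have h2 (σ : Equiv.Perm (Fin p)) : ∑ a : Fin p → Fin 10,
      M.bilinear ((((Equiv.Perm.sign σ : ℤ) : ℝ) •
        (List.ofFn fun i => M.gamma (a (σ i)).castSucc).prod) * A) *
          (List.ofFn fun i => e (a i)).prod =
      sandwich (emb M.pairing * (M.eMat ^ p * emb A)) := by
    -- Reindexing by σ moves the permutation from the Γ's to the e's, whose sign cancels the sign in
    -- the skew-symmetrization; all p! terms become equal.
    rw [h1, ← (Equiv.arrowCongr σ (Equiv.refl (Fin 10))).sum_comp]
    refine Finset.sum_congr rfl fun a _ => ?_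
    have h3 := prod_e_perm (a ∘ σ.symm) σ
    simp only [Function.comp_apply, Equiv.symm_apply_apply] at h3
    simp only [Equiv.arrowCongr_apply, Equiv.coe_refl, Function.comp_apply, id_eq,
      Equiv.symm_apply_apply]
    rw [h3, smul_mul_assoc, bilinear_smul, smul_mul_assoc, mul_smul_comm]
  rw [flux]
  congr 1
  simp only [gammaSkew, smul_mul_assoc, bilinear_smul, Finset.sum_mul, bilinear_sum,
    Finset.smul_sum] at h2 ⊢
  rw [Finset.sum_comm]
  simp only [← Finset.smul_sum, h2]
  rw [Finset.sum_const, Finset.card_univ, Fintype.card_perm, Fintype.card_fin,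
    ← Nat.cast_smul_eq_nsmul ℝ, smul_smul, inv_mul_cancel₀ (by positivity), one_smul]

end MajoranaRep

end SuperIIA

/-! ### Contractions, the differential of E, and the flux recursion -/

namespace SuperIIA

open Matrix CE

theorem sum_comm_four {B κ ι : Type*} [AddCommMonoid B] [Fintype κ] [Fintype ι]
    (f : ι → κ → κ → κ → B) :
    ∑ k, ∑ l, ∑ j, ∑ a, f a k l j = ∑ a, ∑ k, ∑ l, ∑ j, f a k l j := by
  simp only [Finset.sum_comm (s := (Finset.univ : Finset κ))
    (t := (Finset.univ : Finset ι))]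

section Anticommuting

variable {R : Type*} [Ring R] {g V H X : R}

/-- With g = Γ_10 and X an odd power of E, this exhibits the defect as a left plus a right multiple
of W = Vg + H. It serves the case A = 1; the next identity serves A = Γ_10. -/
theorem commutator_eq_of_anticomm (hgg : g * g = 1) (hV : g * V = -(V * g))
    (hH : g * H = -(H * g)) (hX : g * X = -(X * g)) :
    V * X - X * V + -((H * X + X * H) * g) =
      (V * g + H) * (g * X) + X * g * (V * g + H) := by
  have e1 : V * g * (g * X) = V * X := by rw [mul_assoc, ← mul_assoc g, hgg, one_mul]
  have e2 : H * (g * X) = -(H * X * g) := by rw [hX, mul_neg, mul_assoc]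
  have e3 : X * g * (V * g) = -(X * V) := by
    rw [mul_assoc, ← mul_assoc g V, hV, neg_mul, mul_assoc V, hgg, mul_one, mul_neg]
  have e4 : X * g * H = -(X * H * g) := by rw [mul_assoc, hH, mul_neg, ← mul_assoc]
  rw [add_mul (V * g), mul_add (X * g), e1, e2, e3, e4, add_mul]
  abel

theorem commutator_mul_eq_of_anticomm (hX : g * X = -(X * g)) :
    (V * X - X * V) * g + -(H * X + X * H) = (V * g + H) * -X + -X * (V * g + H) := by
  have e1 : V * g * X = -(V * X * g) := by rw [mul_assoc, hX, mul_neg, mul_assoc]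
  rw [mul_neg, neg_mul, add_mul, mul_add, e1, sub_mul, mul_assoc X]
  abel

end Anticommuting

namespace MajoranaRep

variable (M : MajoranaRep)

/-! ### Clifford contractions -/

/-- Contraction of a family of coefficients with the generators `e^a`. -/
theorem slash_mul_eMat {c : Fin 10 → CE} (hc : ∀ a b, c a * e b = e b * c a) :
    slash M.gammaTen c * M.eMat + M.eMat * slash M.gammaTen c =
      (2 : ℝ) • scal (∑ a : Fin 10, minkowski a.castSucc a.castSucc • (c a * e a)) := by
  have h : slash M.gammaTen c * M.eMat + M.eMat * slash M.gammaTen c =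
      ∑ a : Fin 10, ∑ b : Fin 10, emb (M.gamma a.castSucc * M.gamma b.castSucc +
        M.gamma b.castSucc * M.gamma a.castSucc) * scal (c a * e b) := by
    rw [eMat, slash, slash, Finset.sum_mul_sum, Finset.sum_mul_sum,
      Finset.sum_comm (γ := Fin 10) (f := fun i j => emb (M.gammaTen i) * scal (e i) * _),
      ← Finset.sum_add_distrib]
    refine Finset.sum_congr rfl fun a _ => ?_
    rw [← Finset.sum_add_distrib]
    refine Finset.sum_congr rfl fun b _ => ?_
    rw [emb_mul_scal_mul, emb_mul_scal_mul, hc, ← add_mul, ← map_add]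
    rfl
  rw [h, map_sum, Finset.smul_sum]
  refine Finset.sum_congr rfl fun a _ => ?_
  rw [Finset.sum_eq_single a]
  · rw [clifford, map_smul, map_one, smul_mul_assoc, one_mul, scal_smul, smul_smul]
  · intro b _ hb
    rw [clifford, minkowski, if_neg (fun h => hb (Fin.castSucc_injective _ h).symm), mul_zero,
      zero_smul, map_zero, zero_mul]
  · simp

theorem eMat_mul_scal {x : CE} (hx : ∀ a, e a * x = -(x * e a)) :
    M.eMat * scal x = -(scal x * M.eMat) := by
  simp only [eMat, slash, Finset.sum_mul, Finset.mul_sum, ← Finset.sum_neg_distrib]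
  refine Finset.sum_congr rfl fun a _ => ?_
  rw [mul_assoc, ← map_mul, hx, map_neg, mul_neg, map_mul, ← mul_assoc, ← scal_mul_emb, mul_assoc]

theorem e_mul_contraction {c : Fin 10 → CE} (hc : ∀ a b, c a * e b = e b * c a) (b : Fin 10) :
    e b * (∑ a : Fin 10, minkowski a.castSucc a.castSucc • (c a * e a)) =
      -((∑ a : Fin 10, minkowski a.castSucc a.castSucc • (c a * e a)) * e b) := by
  rw [Finset.mul_sum, Finset.sum_mul, ← Finset.sum_neg_distrib]
  refine Finset.sum_congr rfl fun a _ => ?_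
  rw [mul_smul_comm, smul_mul_assoc, ← mul_assoc, ← hc, mul_assoc, mul_assoc, e_e b a, mul_neg,
    smul_neg]

theorem minkowski_smul_gammaUp (a : Fin 11) :
    minkowski a a • M.gammaUp a = M.gamma a := by
  rw [gammaUp_eq, smul_smul, minkowski_self_mul_self, one_smul]

theorem H3A_eq : M.H3A = ∑ a : Fin 10, minkowski a.castSucc a.castSucc •
    (M.bilinear (M.gammaUp a.castSucc * M.gamma 10) * e a) := by
  refine Finset.sum_congr rfl fun a _ => ?_
  rw [← smul_mul_assoc, ← bilinear_smul, ← smul_mul_assoc, minkowski_smul_gammaUp]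

theorem hMat_mul_eMat : M.hMat * M.eMat + M.eMat * M.hMat = (2 : ℝ) • scal M.H3A := by
  rw [hMat, H3A_eq]
  exact M.slash_mul_eMat fun a b => (M.mul_bilinear_comm _ _).symm

theorem e_mul_H3A (b : Fin 10) : e b * M.H3A = -(M.H3A * e b) := by
  rw [H3A_eq]
  exact e_mul_contraction (fun a b => (M.mul_bilinear_comm _ _).symm) b

theorem H3A_mul_psi (α : Fin 32) : M.H3A * psi α = -(psi α * M.H3A) := by
  rw [H3A, Finset.mul_sum, Finset.sum_mul, ← Finset.sum_neg_distrib]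
  refine Finset.sum_congr rfl fun a _ => ?_
  rw [mul_assoc, e_psi, mul_neg, ← mul_assoc, ← mul_assoc, mul_bilinear_comm]

/-! ### The differential on matrices -/

/-- The differential of a matrix. -/
def dMatrix (X : Matrix (Fin 32) (Fin 32) CE) : Matrix (Fin 32) (Fin 32) CE := X.map M.d

/-- The parity involution on matrices. -/
def parityMatrix : Matrix (Fin 32) (Fin 32) CE →ₐ[ℝ] Matrix (Fin 32) (Fin 32) CE :=
  parity.mapMatrix

theorem dMatrix_mul (X Y : Matrix (Fin 32) (Fin 32) CE) :
    M.dMatrix (X * Y) = M.dMatrix X * Y + parityMatrix X * M.dMatrix Y := by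
  ext i j
  simp [dMatrix, parityMatrix, mul_apply, map_sum, d_mul, Finset.sum_add_distrib]

theorem dMatrix_emb (A : Matrix (Fin 32) (Fin 32) ℝ) : M.dMatrix (emb A) = 0 := by
  ext i j
  exact M.d_algebraMap _

theorem parityMatrix_emb (A : Matrix (Fin 32) (Fin 32) ℝ) : parityMatrix (emb A) = emb A := by
  ext i j
  exact parity.commutes _

theorem dMatrix_eMat : M.dMatrix M.eMat = M.vMat := by
  ext i j
  simp [dMatrix, eMat, vMat, slash, Matrix.sum_apply, mul_scal_apply, emb_apply, d_mul,
    d_algebraMap, d_e]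

theorem parityMatrix_scal (x : CE) : parityMatrix (scal x) = scal (parity x) := by
  ext i j
  simp only [parityMatrix, scal, scalar_apply, AlgHom.mapMatrix_apply, map_apply, diagonal_apply]
  split_ifs <;> simp

theorem parityMatrix_eMat : parityMatrix M.eMat = -M.eMat := by
  rw [eMat, slash, map_sum, ← Finset.sum_neg_distrib]
  refine Finset.sum_congr rfl fun a _ => ?_
  rw [map_mul, parityMatrix_emb, parityMatrix_scal, e, parity_gen, map_neg, mul_neg]

theorem dMatrix_eMat_pow_succ (k : ℕ) : M.dMatrix (M.eMat ^ (k + 1)) =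
    M.dMatrix (M.eMat ^ k) * M.eMat + (-1 : ℝ) ^ k • (M.eMat ^ k * M.vMat) := by
  rw [pow_succ, dMatrix_mul, dMatrix_eMat, map_pow, parityMatrix_eMat, ← neg_one_smul ℝ M.eMat,
    smul_pow, smul_mul_assoc]

/-- Both ψ's are closed, and d picks up a sign on passing the left one. The same sign occurs in
`mul_sandwich`, so the two cancel in the recursion. -/
theorem d_sandwich (X : Matrix (Fin 32) (Fin 32) CE) :
    M.d (sandwich X) = -sandwich (M.dMatrix X) := by
  simp only [sandwich, dotProduct, mulVec, map_sum, d_mul, d_psi, dMatrix, map_apply, zero_mul,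
    mul_zero, add_zero, zero_add, ← Finset.sum_neg_distrib, ← neg_mul]
  refine Finset.sum_congr rfl fun i _ => ?_
  rw [psi, parity_gen]

theorem two_smul_dMatrix_eMat_pow (m : ℕ) : (2 : ℝ) • M.dMatrix (M.eMat ^ (m + 1)) =
    ((m : ℝ) + 1) • (M.vMat * M.eMat ^ m + (-1 : ℝ) ^ m • (M.eMat ^ m * M.vMat)) := by
  have hc : ∀ a b : Fin 10, M.bilinear (M.gammaUp a.castSucc) * e b =
    e b * M.bilinear (M.gammaUp a.castSucc) := fun a b => (M.mul_bilinear_comm _ _).symm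
  refine two_smul_derivation_pow (M.slash_mul_eMat hc)
    (M.eMat_mul_scal (e_mul_contraction hc)) (D := fun k => M.dMatrix (M.eMat ^ k)) ?_
    M.dMatrix_eMat_pow_succ m
  have h := M.dMatrix_emb 1
  rwa [map_one] at h

/-! ### The cubic identity -/

/-- The matrix `Γ_a Γ_10 (ψ̄ Γ^a ψ) + Γ_a (ψ̄ Γ^a Γ_10 ψ)`. -/
def wMat : Matrix (Fin 32) (Fin 32) CE := M.vMat * emb (M.gamma 10) + M.hMat

theorem wMat_apply (i j : Fin 32) : M.wMat i j = ∑ a : Fin 10,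
    ((M.gamma a.castSucc * M.gamma 10) i j • M.bilinear (M.gammaUp a.castSucc) +
      M.gamma a.castSucc i j • M.bilinear (M.gammaUp a.castSucc * M.gamma 10)) := by
  rw [wMat, vMat, hMat, slash, slash, Finset.sum_mul, ← Finset.sum_add_distrib, Matrix.sum_apply]
  refine Finset.sum_congr rfl fun a _ => ?_
  rw [mul_assoc, scal_mul_emb, ← mul_assoc, ← map_mul, Matrix.add_apply, mul_scal_apply,
    mul_scal_apply, emb_apply, emb_apply, ← Algebra.smul_def, ← Algebra.smul_def]
  rfl

theorem quad_mul_sum (A : Matrix (Fin 32) (Fin 32) ℝ) (r x : Fin 32 → ℝ) :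
    ∑ k, ∑ l, ∑ j, (r j * (M.pairing * A) k l) * (x k * x l * x j) =
      M.quad A x * ∑ j, r j * x j := by
  rw [quad, dotProduct, Finset.sum_mul]
  refine Finset.sum_congr rfl fun k _ => ?_
  rw [mulVec, dotProduct, Finset.mul_sum _ _ (x k), Finset.sum_mul]
  refine Finset.sum_congr rfl fun l _ => ?_
  rw [Finset.mul_sum]
  refine Finset.sum_congr rfl fun j _ => ?_
  ring

theorem bilinear_mul_sum (A : Matrix (Fin 32) (Fin 32) ℝ) (r : Fin 32 → ℝ) :
    ∑ k, ∑ l, ∑ j, (r j * (M.pairing * A) k l) • (psi k * psi l * psi j) =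
      M.bilinear A * ∑ j, r j • psi j := by
  rw [bilinear, Finset.sum_mul]
  refine Finset.sum_congr rfl fun k _ => ?_
  rw [Finset.sum_mul]
  refine Finset.sum_congr rfl fun l _ => ?_
  rw [Finset.mul_sum]
  refine Finset.sum_congr rfl fun j _ => ?_
  rw [smul_mul_smul_comm, mul_comm (r j)]

theorem wMat_mulVec_psi : M.wMat *ᵥ psi = 0 := by
  ext i
  -- Coefficients of the i-th component of Wψ as a cubic polynomial in ψ, with k, l the indices
  -- inside the bilinear.
  let t : Fin 32 → Fin 32 → Fin 32 → ℝ := fun k l j => ∑ a : Fin 10,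
    ((M.gamma a.castSucc * M.gamma 10) i j * (M.pairing * M.gammaUp a.castSucc) k l +
      M.gamma a.castSucc i j * (M.pairing * (M.gammaUp a.castSucc * M.gamma 10)) k l)
  have h := cubic_psi_eq_zero t (fun x => by
    refine Eq.trans ?_ (congrFun (M.cubic_eq_zero x) i)
    rw [cubic, Finset.sum_apply]
    simp only [t, Finset.sum_mul]
    rw [sum_comm_four]
    refine Finset.sum_congr rfl fun a _ => ?_
    simp only [add_mul, Finset.sum_add_distrib]
    rw [quad_mul_sum, quad_mul_sum, gammaUp_eq, smul_mul_assoc, quad_smul, quad_smul]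
    simp only [Pi.smul_apply, Pi.add_apply, smul_eq_mul, mulVec, dotProduct]
    ring)
  refine Eq.trans ?_ h
  simp only [t, Finset.sum_smul]
  rw [sum_comm_four]
  simp only [mulVec, dotProduct, wMat_apply, Finset.sum_mul]
  rw [Finset.sum_comm]
  refine Finset.sum_congr rfl fun a _ => ?_
  simp only [add_smul, add_mul, Finset.sum_add_distrib]
  rw [bilinear_mul_sum, bilinear_mul_sum]
  simp only [Finset.mul_sum, mul_smul_comm, smul_mul_assoc]

/-- The matrices ηΓ_a and ηΓ_aΓ_10 are symmetric and the bilinears are central, so ψᵀ(ηW) has the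
same components as ηWψ. -/
theorem psi_vecMul_wMat : psi ᵥ* (emb M.pairing * M.wMat) = 0 := by
  have hsymm1 (a : Fin 11) : (M.pairing * M.gamma a)ᵀ = M.pairing * M.gamma a := by
    rw [transpose_mul, pairing_skew, mul_neg, gamma_skew_adjoint, neg_neg]
  have hsymm2 (a : Fin 10) : (M.pairing * (M.gamma a.castSucc * M.gamma 10))ᵀ =
      M.pairing * (M.gamma a.castSucc * M.gamma 10) := by
    rw [← mul_assoc, transpose_mul, hsymm1, ← mul_assoc, gamma_skew_adjoint, neg_mul, mul_assoc,
      gamma_ten_mul, mul_neg, neg_neg, mul_assoc]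
  have hW (i j : Fin 32) : (emb M.pairing * M.wMat) i j = ∑ a : Fin 10,
      ((M.pairing * (M.gamma a.castSucc * M.gamma 10)) i j • M.bilinear (M.gammaUp a.castSucc) +
        (M.pairing * M.gamma a.castSucc) i j •
          M.bilinear (M.gammaUp a.castSucc * M.gamma 10)) := by
    simp only [mul_apply (M := emb M.pairing), wMat_apply, emb_apply, ← Algebra.smul_def,
      Finset.smul_sum, smul_add, smul_smul]
    rw [Finset.sum_comm]
    refine Finset.sum_congr rfl fun a _ => ?_
    rw [Finset.sum_add_distrib, ← Finset.sum_smul, ← Finset.sum_smul, mul_apply (M := M.pairing),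
      mul_apply (M := M.pairing)]
  have h : psi ᵥ* (emb M.pairing * M.wMat) = (emb M.pairing * M.wMat) *ᵥ psi := by
    ext j
    simp only [vecMul, mulVec, dotProduct]
    refine Finset.sum_congr rfl fun i _ => ?_
    rw [hW, hW, Finset.mul_sum, Finset.sum_mul]
    refine Finset.sum_congr rfl fun a _ => ?_
    rw [← hsymm1, ← hsymm2, transpose_apply, transpose_apply, hsymm1, hsymm2, mul_add, add_mul,
      mul_smul_comm, mul_smul_comm, smul_mul_assoc, smul_mul_assoc, mul_bilinear_comm,
      mul_bilinear_comm]
  rw [h, ← mulVec_mulVec, wMat_mulVec_psi, mulVec_zero]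

/-! ### The recursion of flux densities -/

theorem emb_gamma_ten_mul_slash (c : Fin 10 → CE) :
    emb (M.gamma 10) * slash M.gammaTen c = -(slash M.gammaTen c * emb (M.gamma 10)) := by
  rw [slash, Finset.mul_sum, Finset.sum_mul, ← Finset.sum_neg_distrib]
  refine Finset.sum_congr rfl fun a _ => ?_
  rw [mul_assoc, scal_mul_emb, ← mul_assoc, ← mul_assoc, ← map_mul, gammaTen, gamma_ten_mul,
    map_neg, map_mul, neg_mul]

theorem emb_gamma_ten_mul_self : emb (M.gamma 10) * emb (M.gamma 10) = 1 := by
  rw [← map_mul, gamma_ten_mul_self, map_one]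

theorem emb_gamma_ten_mul_eMat_pow {n : ℕ} (hn : Odd n) :
    emb (M.gamma 10) * M.eMat ^ n = -(M.eMat ^ n * emb (M.gamma 10)) := by
  have h := pow_mul_of_anticomm (E := M.eMat) (H := emb (M.gamma 10)) (by
    rw [eMat, emb_gamma_ten_mul_slash, neg_neg]) n
  rw [h, hn.neg_one_pow, neg_one_smul, neg_neg]

/-- The pairs of spinor matrices that accompany consecutive flux densities. -/
def Consecutive (A A' : Matrix (Fin 32) (Fin 32) ℝ) : Prop :=
  (A = 1 ∧ A' = M.gamma 10) ∨ (A = M.gamma 10 ∧ A' = 1)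

theorem sandwich_commutator_eq {A A' : Matrix (Fin 32) (Fin 32) ℝ} (hA : M.Consecutive A A')
    {n : ℕ} (hn : Odd n) :
    sandwich (emb M.pairing * ((M.vMat * M.eMat ^ n - M.eMat ^ n * M.vMat) * emb A)) =
      sandwich (emb M.pairing * ((M.hMat * M.eMat ^ n + M.eMat ^ n * M.hMat) * emb A')) := by
  have hg := M.emb_gamma_ten_mul_eMat_pow hn
  have hgg := M.emb_gamma_ten_mul_self
  have hv : emb (M.gamma 10) * M.vMat = -(M.vMat * emb (M.gamma 10)) :=
    M.emb_gamma_ten_mul_slash _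
  have hh : emb (M.gamma 10) * M.hMat = -(M.hMat * emb (M.gamma 10)) :=
    M.emb_gamma_ten_mul_slash _
  have hl (X : Matrix (Fin 32) (Fin 32) CE) : sandwich (emb M.pairing * M.wMat * X) = 0 :=
    sandwich_mul_of_vecMul_eq_zero M.psi_vecMul_wMat X
  have hr (X : Matrix (Fin 32) (Fin 32) CE) : sandwich (X * M.wMat) = 0 :=
    sandwich_mul_of_mulVec_eq_zero M.wMat_mulVec_psi X
  rw [← sub_eq_zero, sub_eq_add_neg, ← sandwich_neg, ← sandwich_add]
  rcases hA with ⟨rfl, rfl⟩ | ⟨rfl, rfl⟩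
  · have h1 := hl (emb (M.gamma 10) * M.eMat ^ n)
    have h2 := hr (emb M.pairing * (M.eMat ^ n * emb (M.gamma 10)))
    refine Eq.trans ?_ ((congrArg₂ (· + ·) h1 h2).trans (add_zero 0))
    rw [← sandwich_add, mul_assoc (emb M.pairing), mul_assoc (emb M.pairing), ← mul_add,
      ← mul_neg, ← mul_add, map_one, mul_one]
    exact congrArg (fun Y => sandwich (emb M.pairing * Y))
      (commutator_eq_of_anticomm hgg hv hh hg)
  · have h1 := hl (-M.eMat ^ n)
    have h2 := hr (emb M.pairing * (-M.eMat ^ n))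
    refine Eq.trans ?_ ((congrArg₂ (· + ·) h1 h2).trans (add_zero 0))
    rw [← sandwich_add, mul_assoc (emb M.pairing), mul_assoc (emb M.pairing), ← mul_add,
      ← mul_neg, ← mul_add, map_one, mul_one]
    exact congrArg (fun Y => sandwich (emb M.pairing * Y)) (commutator_mul_eq_of_anticomm hg)

/-- The exponent q + 1 is odd, so d(E^(q+2)) is a commutator with V while H_3^A E^q is an
anticommutator with H; the Fierz identity equates their sandwiches. -/
theorem d_flux {A A' : Matrix (Fin 32) (Fin 32) ℝ} (hA : M.Consecutive A A') {q : ℕ}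
    (hq : Even q) : M.d (M.flux (q + 2) A) = M.H3A * M.flux q A' := by
  have hodd : Odd (q + 1) := hq.add_one
  have h1 := M.two_smul_dMatrix_eMat_pow (q + 1)
  have h2 := smul_mul_pow M.hMat_mul_eMat (M.eMat_mul_scal M.e_mul_H3A) q
  rw [hodd.neg_one_pow, neg_one_smul, ← sub_eq_add_neg] at h1
  rw [hodd.neg_one_pow, neg_one_smul, sub_neg_eq_add] at h2
  have h3 := M.sandwich_commutator_eq hA hodd
  rw [flux_eq_sandwich M (hq.add even_two), flux_eq_sandwich M hq, map_smul, d_sandwich,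
    mul_smul_comm, mul_sandwich M.H3A_mul_psi]
  have h4 : M.dMatrix (emb M.pairing * (M.eMat ^ (q + 2) * emb A)) =
      emb M.pairing * (M.dMatrix (M.eMat ^ (q + 2)) * emb A) := by
    rw [dMatrix_mul, dMatrix_mul, dMatrix_emb, dMatrix_emb, parityMatrix_emb]
    simp
  have h5 : scal M.H3A * (emb M.pairing * (M.eMat ^ q * emb A')) =
      emb M.pairing * ((scal M.H3A * M.eMat ^ q) * emb A') := by
    rw [← mul_assoc, scal_mul_emb]
    simp only [mul_assoc]
  have h6 : M.dMatrix (M.eMat ^ (q + 2)) =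
      (((q : ℝ) + 2) / 2) • (M.vMat * M.eMat ^ (q + 1) - M.eMat ^ (q + 1) * M.vMat) := by
    rw [← inv_smul_smul₀ (two_ne_zero (α := ℝ)) (M.dMatrix (M.eMat ^ (q + 2))), h1, smul_smul]
    congr 1
    push_cast
    ring
  have h7 : scal M.H3A * M.eMat ^ q = (2 * ((q : ℝ) + 1))⁻¹ •
      (M.hMat * M.eMat ^ (q + 1) + M.eMat ^ (q + 1) * M.hMat) := by
    rw [← h2, inv_smul_smul₀ (by positivity)]
  rw [h4, h5, h6, h7, smul_mul_assoc, smul_mul_assoc, mul_smul_comm, mul_smul_comm,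
    sandwich_smul, sandwich_smul, h3, ← smul_neg, ← smul_neg, smul_smul, smul_smul]
  congr 1
  -- The two prefactors agree: (q+2)/2 over (q+2)! is 1/(2(q+1)) over q!.
  have h8 : (q + 2).factorial = (q + 2) * ((q + 1) * q.factorial) := by
    rw [← Nat.factorial_succ, ← Nat.factorial_succ]
  rw [h8]
  push_cast
  field_simp

theorem H3A_mul_flux_ten (A : Matrix (Fin 32) (Fin 32) ℝ) : M.H3A * M.flux 10 A = 0 := by
  rw [H3A, flux, mul_smul_comm, Finset.sum_mul_sum]
  refine smul_eq_zero_of_right _ (Finset.sum_eq_zero fun a _ => Finset.sum_eq_zero fun b _ => ?_)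
  have h := prod_e_eq_zero (Fin.cons a b)
  rw [List.ofFn_succ, List.prod_cons] at h
  simp only [Fin.cons_zero, Fin.cons_succ] at h
  rw [mul_assoc, ← mul_assoc (e a), mul_bilinear_comm, mul_assoc, h, mul_zero, mul_zero]

end MajoranaRep

end SuperIIA

theorem mainTheorem10 (M : SuperIIA.MajoranaRep) :
    M.d M.F8 = M.H3A * M.F6 ∧
    M.d M.F10 = M.H3A * M.F8 ∧
    M.d M.F12 = M.H3A * M.F10 ∧
    M.H3A * M.F12 = 0 :=
  ⟨M.d_flux (Or.inl ⟨rfl, rfl⟩) (q := 4) (by decide),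
    M.d_flux (Or.inr ⟨rfl, rfl⟩) (q := 6) (by decide),
    M.d_flux (Or.inl ⟨rfl, rfl⟩) (q := 8) (by decide), M.H3A_mul_flux_ten 1⟩
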